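/- Let $G$ be a locally compact Hausdorff abelian group with character group $\Gamma$ (write $(x,\gamma)$ for the value of the character $\gamma\in\Gamma$ at $x\in G$), and fix Haar measures $\mu_G,\mu_\Gamma$. Let $f:G\to\mathbb C$ be \emph{regular}: $f$ is continuous and integrable, and its Fourier transform $\hat f(\gamma)=\int_G f(x)\overline{(x,\gamma)}\,d\mu_G(x)$ is integrable over $\Gamma$; put $\|\hat f\|_1=\int_\Gamma|\hat f|\,d\mu_\Gamma$. Let $m\ge 1$ be an integer and $\lambda>0$ a real number. A \emph{triple Poisson tower} with parameters $m,\lambda$ is a family $X=(X^{(j)}_k)_{k\in\mathbb Z,\,j=1,2,3}$ of independent $G$-valued random variables such that each $X^{(j)}_k$ is distributed as a sum of $N$ independent copies of $R$, where $R$ is a $G$-valued random variable (whose law does not depend on $j,k$) and $N\sim\mathrm{Poisson}(\lambda e^{-k/m})$ is independent of these copies. (If $G$ is not second countable, the $X_k^{(j)}$ are assumed to be almost surely equal to pointwise limits of sequences of simple functions.) In particular this covers the sketch of a vector $\mathbf x\in G^n$ with $\lambda=\|\mathbf x\|_0=|\{v:\mathbf x(v)\neq0\}|>0$, in which $X^{(j)}_k=\sum_{v=1}^n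 Z^{(j)}_{v,k}\,\mathbf x(v)$ with independent $Z^{(j)}_{v,k}\sim\mathrm{Poisson}(e^{-k/m})$. Define $$\phi_{f,m}(X)=\int_\Gamma \hat f(\gamma)\,\frac{\prod_{j=1}^3\Big(\sum_{k=-\infty}^{\infty}\big((X_k^{(j)},\gamma)-1\big)e^{\frac13k/m}\Big)}{m^3|\Gamma(-1/3)|^3}\,d\mu_\Gamma(\gamma),$$ and, for integers $a,b$, $$\phi_{f,m;a,b}(X)=\int_\Gamma \hat f(\gamma)\,\frac{\prod_{j=1}^3\Big(\sum_{k=a}^{b-1}\big((X_k^{(j)},\gamma)-1\big)e^{\frac13k/m}-\frac{e^{\frac13(a-1)/m}}{1-e^{-1/(3m)}}\Big)}{m^3|\Gamma(-1/3)|^3}\,d\mu_\Gamma(\gamma),$$ where $\Gamma(-1/3)$ is a value of the Gamma function. For a complex random variable $Y$ let $\mathbb V Y=\mathbb E|Y-\mathbb E Y|^2$. Theorem. If $a\le m(\ln\lambda-6\ln m)$ and $b\ge m(\ln\lambda+3\ln m)$, then both estimators are almost surely well defined (the series converge absolutely for all $\gamma$ and $j$, and the integrals over $\Gamma$ converge absolutely)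 and have finite second moments, and 1. $\mathbb E\,\phi_{f,m;a,b}(X)=\mathbb E\,\phi_{f,m}(X)+\lambda\|\hat f\|_1\,O(m^{-2})$, 2. $\mathbb V\,\phi_{f,m;a,b}(X)=\mathbb V\,\phi_{f,m}(X)+\lambda^2\|\hat f\|_1^2\,O(m^{-2})$, where the constants in $O(m^{-2})$ are absolute: the bounds hold for all $m\ge1$ with a constant that does not depend on $G$, the Haar measures, $f$, $\lambda$, the law of $R$, $a$, $b$ or $m$. -/

import Mathlib

open MeasureTheory ProbabilityTheory

universe u v

namespace PoissonTower

/-- The character group of an additive topological group `G`: continuous homomorphisms from `G`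
to the unit circle, with the compact-open topology. -/
abbrev CharGroup (G : Type u) [AddCommGroup G] [TopologicalSpace G] : Type u :=
  PontryaginDual (Multiplicative G)

section Fourier

variable {G : Type u} [AddCommGroup G] [TopologicalSpace G]

/-- The value `(x, γ)` of the character `γ` at `x`, as a complex number. -/
noncomputable def ch (x : G) (γ : CharGroup G) : ℂ :=
  ((γ (Multiplicative.ofAdd x) : Circle) : ℂ)

variable [MeasurableSpace G] [MeasurableSpace (CharGroup G)]

/-- The Fourier transform of `f`, with respect to the measure `μ` on `G`. -/
noncomputable def fourier (μ : Measure G) (f : G → ℂ) (γ : CharGroup G) : ℂ :=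
  ∫ x, f x * (starRingEnd ℂ) (ch x γ) ∂μ

/-- Regular functions: continuous, integrable, and with integrable Fourier transform. -/
structure IsRegular (μ : Measure G) (ν : Measure (CharGroup G)) (f : G → ℂ) : Prop where
  continuous : Continuous f
  integrable : Integrable f μ
  integrable_fourier : Integrable (fourier μ f) ν

/-- The `L¹` norm of the Fourier transform of `f`. -/
noncomputable def fourierNorm (μ : Measure G) (ν : Measure (CharGroup G)) (f : G → ℂ) : ℝ :=
  ∫ γ, ‖fourier μ f γ‖ ∂ν

end Fourier

section Estimator

variable {G : Type u} [AddCommGroup G] [TopologicalSpace G]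

/-- The summand `((x_k, γ) - 1) e^{k/(3m)}` of the `(-1/3)`-aggregation. -/
noncomputable def aggTerm (m : ℕ) (x : ℤ → G) (γ : CharGroup G) (k : ℤ) : ℂ :=
  (ch (x k) γ - 1) * (Real.exp ((1 / 3 : ℝ) * (k : ℝ) / (m : ℝ)) : ℂ)

/-- The `(-1/3)`-aggregation of all the cells. -/
noncomputable def agg (m : ℕ) (x : ℤ → G) (γ : CharGroup G) : ℂ :=
  ∑' k : ℤ, aggTerm m x γ k

/-- The `(-1/3)`-aggregation of the cells `a ≤ k < b`. -/
noncomputable def aggTrunc (m : ℕ) (a b : ℤ) (x : ℤ → G) (γ : CharGroup G) : ℂ :=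
  ∑ k ∈ Finset.Ico a b, aggTerm m x γ k

/-- The constant `e^{(a-1)/(3m)} / (1 - e^{-1/(3m)})`. -/
noncomputable def correction (m : ℕ) (a : ℤ) : ℝ :=
  Real.exp ((1 / 3 : ℝ) * ((a : ℝ) - 1) / (m : ℝ)) * (1 / (1 - Real.exp (-1 / (3 * (m : ℝ)))))

/-- The normalising factor `m³ |Γ(-1/3)|³`. -/
noncomputable def normalizer (m : ℕ) : ℝ :=
  (m : ℝ) ^ 3 * |Real.Gamma (-1 / 3)| ^ 3

variable [MeasurableSpace G] [MeasurableSpace (CharGroup G)]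

/-- The function integrated over the character group in the estimator `estimator`;
`x j k` is the content of cell `k` of the `j`-th tower. -/
noncomputable def integrand (μ : Measure G) (f : G → ℂ) (m : ℕ) (x : Fin 3 → ℤ → G)
    (γ : CharGroup G) : ℂ :=
  fourier μ f γ * ((∏ j : Fin 3, agg m (x j) γ) / (normalizer m : ℂ))

/-- The Poisson tower estimator `φ_{f,m}`. -/
noncomputable def estimator (μ : Measure G) (ν : Measure (CharGroup G)) (f : G → ℂ) (m : ℕ)
    (x : Fin 3 → ℤ → G) : ℂ :=
  ∫ γ, integrand μ f m x γ ∂ν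

/-- The function integrated over the character group in the truncated estimator. -/
noncomputable def integrandTrunc (μ : Measure G) (f : G → ℂ) (m : ℕ) (a b : ℤ)
    (x : Fin 3 → ℤ → G) (γ : CharGroup G) : ℂ :=
  fourier μ f γ *
    ((∏ j : Fin 3, (aggTrunc m a b (x j) γ - (correction m a : ℂ))) / (normalizer m : ℂ))

/-- The `(a,b)`-truncated estimator `φ_{f,m;a,b}`. -/
noncomputable def estimatorTrunc (μ : Measure G) (ν : Measure (CharGroup G)) (f : G → ℂ) (m : ℕ)
    (a b : ℤ) (x : Fin 3 → ℤ → G) : ℂ :=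
  ∫ γ, integrandTrunc μ f m a b x γ ∂ν

end Estimator

section Tower

variable {G : Type u} [AddCommGroup G] [MeasurableSpace G]

/-- The compound Poisson distribution: the law of `R₀ + ⋯ + R_{N-1}`, where `N` has the Poisson
distribution of mean `s`, the `R_i` have law `μR`, and all of these are independent. -/
noncomputable def compoundPoisson (s : ℝ) (μR : Measure G) : Measure G :=
  Measure.map (fun p : ℕ × (ℕ → G) => ∑ r ∈ Finset.range p.1, p.2 r)
    ((poissonMeasure s.toNNReal).prod (Measure.infinitePi fun _ : ℕ => μR))

variable [TopologicalSpace G] {Ω : Type v} [MeasurableSpace Ω]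

/-- A triple Poisson tower with parameters `m`, `lam` and `R ∼ μR`: the cells `X j k`
(tower `j`, index `k`) are independent, and `X j k` is distributed as the sum of a
`Poisson(lam * e^{-k/m})` number of independent copies of `R`.
The field `aestronglyMeasurable` is automatic if `G` is second countable. -/
structure IsTriplePoissonTower (P : Measure Ω) (m : ℕ) (lam : ℝ) (μR : Measure G)
    (X : Fin 3 → ℤ → Ω → G) : Prop where
  isProbabilityMeasure : IsProbabilityMeasure μR
  aestronglyMeasurable : ∀ j k, AEStronglyMeasurable (X j k) P
  law : ∀ j k, HasLaw (X j k) (compoundPoisson (lam * Real.exp (-(k : ℝ) / (m : ℝ))) μR) P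
  indep : iIndepFun (fun i : Fin 3 × ℤ => X i.1 i.2) P

/-- The triple Poisson tower sketch of the vector `x ∈ Gⁿ`: cell `k` of tower `j` contains
`∑_v Z_{v,k} x(v)` with independent `Z_{v,k} ∼ Poisson(e^{-k/m})`, independently for
`j = 0, 1, 2`. -/
def IsTripleSketch (P : Measure Ω) (m : ℕ) {n : ℕ} (x : Fin n → G)
    (X : Fin 3 → ℤ → Ω → G) : Prop :=
  ∃ Z : Fin 3 → ℤ → Fin n → Ω → ℕ,
    (∀ j k v, HasLaw (Z j k v) (poissonMeasure (Real.exp (-(k : ℝ) / (m : ℝ))).toNNReal) P) ∧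
    iIndepFun (fun i : Fin 3 × ℤ × Fin n => Z i.1 i.2.1 i.2.2) P ∧
    ∀ j k ω, X j k ω = ∑ v, Z j k v ω • x v

/-- The number `‖x‖₀` of non-zero coordinates of a vector. -/
noncomputable def supportSize {n : ℕ} (x : Fin n → G) : ℕ :=
  Set.ncard {v | x v ≠ 0}

end Tower

/-- The mean of a complex random variable. -/
noncomputable def mean {Ω : Type v} [MeasurableSpace Ω] (P : Measure Ω) (Y : Ω → ℂ) : ℂ :=
  ∫ ω, Y ω ∂P

/-- The variance `E (Y - E Y) conj(Y - E Y) = E |Y - E Y|²` of a complex random variable. -/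
noncomputable def complexVariance {Ω : Type v} [MeasurableSpace Ω] (P : Measure Ω)
    (Y : Ω → ℂ) : ℝ :=
  ∫ ω, ‖Y ω - mean P Y‖ ^ 2 ∂P

end PoissonTower

/-!
The comparison rests on one property of the cells: cell `k` of each tower is nonzero with probability
at most `pₖ = min(1, λ e^{-k/m})`, so that `(Xₖ, γ) - 1` has mean and covariance `O(pₖ)` uniformly in
the characters (`norm_cellMean_le`, `norm_cellCov_le`). Compound Poisson cells have it because
`P(Poisson(s) ≠ 0) ≤ s`, and sketches by a union bound over the support; the rest of the law is
irrelevant (`IsSparseTower`).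

Full and truncated aggregations are both of the form `∑ₖ ((Xₖ, γ) - 1) wₖ - κ` (`weightedAgg`), with
`0 ≤ wₖ ≤ e^{k/(3m)}`. The random variable `∑ₖ 2wₖ 1{Xₖ ≠ 0}` (`dominator`) bounds such a sum for all
`γ` simultaneously and lies in `L²`, since `∑ₖ wₖ √pₖ` converges. This gives convergence, square
integrability and every exchange of sums, integrals and expectations. The Haar measure of the
character group need not be `σ`-finite, so `|f̂|` is first absorbed into it, which leaves a finite
measure and a factor of modulus at most `1` (`integral_phase_mul`).

By independence, the mean of an estimator is the integral of the product of three means of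
aggregations, and its variance is the double integral of `∏ⱼ (cⱼ + qⱼ) - ∏ⱼ qⱼ`, where `cⱼ` is the
covariance of the `j`-th aggregation at two characters, which is a sum over single cells, and `qⱼ` is
a product of two means (`IsSparseTower.mean_weightedEst`,
`IsSparseTower.complexVariance_weightedEst`).

Summing geometric series on both sides of `k = m log λ` shows that means are `O(m λ^{1/3})` and
covariances `O(m λ^{2/3})`; under the conditions on `a` and `b` the truncated tails change them by
only `O(λ^{1/3} / m)` and `O(λ^{2/3})` (`aggMean_bounds`, `aggCov_bounds`). So the product of means
changes by `O(m λ)` and, the dominant terms being `c q q`, the integrand of the variance by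
`O(m⁴ λ²)`. Division by the normalising factors, of order `m³` and `m⁶`, leaves `O(m⁻²)` in both.
-/

namespace PoissonTower

/-! ### Geometric tails over the integers -/

lemma inv_one_sub_exp_neg_le {r : ℝ} (hr : 0 < r) : (1 - Real.exp (-r))⁻¹ ≤ 1 + 1 / r := by
  have h1 : Real.exp (-r) ≤ (1 + r)⁻¹ := by
    rw [Real.exp_neg]
    exact inv_anti₀ (by linarith) (by linarith [Real.add_one_le_exp r])
  have h2 : r / (1 + r) ≤ 1 - Real.exp (-r) := by
    have : r / (1 + r) = 1 - (1 + r)⁻¹ := by field_simp; ring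
    linarith
  calc (1 - Real.exp (-r))⁻¹ ≤ (r / (1 + r))⁻¹ := inv_anti₀ (by positivity) h2
    _ = 1 + 1 / r := by field_simp; ring

lemma hasSum_exp_lt {r : ℝ} (hr : 0 < r) (a : ℤ) :
    HasSum (fun k : ℤ => if k < a then Real.exp (r * k) else 0)
      (Real.exp (r * (a - 1)) * (1 - Real.exp (-r))⁻¹) := by
  have hinj : Function.Injective (fun n : ℕ => a - 1 - (n : ℤ)) := fun n n' h => by
    simp only at h; omega
  rw [← hinj.hasSum_iff]
  · have h := (hasSum_geometric_of_lt_one (Real.exp_nonneg (-r))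
      (by rw [Real.exp_lt_one_iff]; linarith)).mul_left (Real.exp (r * (a - 1)))
    refine Eq.mpr (congrArg (HasSum · _ _) (funext fun n => ?_)) h
    have hn : a - 1 - (n : ℤ) < a := by omega
    simp only [Function.comp, hn, if_true]
    rw [← Real.exp_nat_mul, ← Real.exp_add]
    push_cast
    ring_nf
  · intro k hk
    have : ¬ k < a := fun h => hk ⟨(a - 1 - k).toNat, by simp only; omega⟩
    simp [this]

lemma hasSum_exp_ge {r : ℝ} (hr : 0 < r) (b : ℤ) :
    HasSum (fun k : ℤ => if b ≤ k then Real.exp (-(r * k)) else 0)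
      (Real.exp (-(r * b)) * (1 - Real.exp (-r))⁻¹) := by
  have h := (Equiv.neg ℤ).hasSum_iff.2 (hasSum_exp_lt hr (1 - b))
  convert h using 1
  · ext k
    have : b ≤ k ↔ -k < 1 - b := by omega
    simp only [Function.comp, Equiv.neg_apply, this, Int.cast_neg, mul_neg]
  · push_cast
    ring_nf

section Tails

variable {m : ℕ}

lemma tsum_exp_lt_le (hm : 1 ≤ m) {α y : ℝ} (hα : 0 < α) {a : ℤ} (ha : (a : ℝ) - 1 ≤ m * y) :
    Summable (fun k : ℤ => if k < a then Real.exp (α * k / m) else 0) ∧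
      ∑' k : ℤ, (if k < a then Real.exp (α * k / m) else 0) ≤
        (1 + m / α) * Real.exp (α * y) := by
  have hm' : (0 : ℝ) < m := by exact_mod_cast hm
  have h := hasSum_exp_lt (div_pos hα hm') a
  simp only [show ∀ k : ℤ, α / m * (k : ℝ) = α * k / m from fun k => by ring] at h
  refine ⟨h.summable, h.tsum_eq.trans_le ?_⟩
  rw [mul_comm]
  have h1 : (1 - Real.exp (-(α / m)))⁻¹ ≤ 1 + m / α := by
    simpa using inv_one_sub_exp_neg_le (div_pos hα hm')
  have h2 : α / m * ((a : ℝ) - 1) ≤ α * y := by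
    rw [div_mul_eq_mul_div, div_le_iff₀ hm', mul_assoc, mul_comm y]
    gcongr
  gcongr

lemma tsum_exp_ge_le (hm : 1 ≤ m) {δ y : ℝ} (hδ : 0 < δ) {b : ℤ} (hb : m * y ≤ (b : ℝ)) :
    Summable (fun k : ℤ => if b ≤ k then Real.exp (-(δ * k / m)) else 0) ∧
      ∑' k : ℤ, (if b ≤ k then Real.exp (-(δ * k / m)) else 0) ≤
        (1 + m / δ) * Real.exp (-(δ * y)) := by
  have hm' : (0 : ℝ) < m := by exact_mod_cast hm
  have h := hasSum_exp_ge (div_pos hδ hm') b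
  simp only [show ∀ k : ℤ, δ / m * (k : ℝ) = δ * k / m from fun k => by ring] at h
  refine ⟨h.summable, h.tsum_eq.trans_le ?_⟩
  rw [mul_comm]
  have h1 : (1 - Real.exp (-(δ / m)))⁻¹ ≤ 1 + m / δ := by
    simpa using inv_one_sub_exp_neg_le (div_pos hδ hm')
  have h2 : δ * y ≤ δ / m * (b : ℝ) := by
    rw [div_mul_eq_mul_div, le_div_iff₀ hm', mul_assoc, mul_comm y]
    gcongr
  have h3 : -(δ * (b : ℝ) / m) ≤ -(δ * y) := by
    rw [div_mul_eq_mul_div] at h2; linarith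
  gcongr

/-- Tails of the series `∑ₖ min(1, e^{β(x - k/m)}) e^{αk/m}`, whose terms grow geometrically for
`k < mx` and, as `α < β`, decay geometrically for `k > mx`. -/
lemma tsum_min_one_exp_tail_le (hm : 1 ≤ m) {α β x y z : ℝ} (hα : 0 < α) (hαβ : α < β) {a b : ℤ}
    (ha : (a : ℝ) - 1 ≤ m * y) (hb : m * z ≤ (b : ℝ)) :
    Summable (fun k : ℤ => if k < a ∨ b ≤ k then
        min 1 (Real.exp (β * (x - k / m))) * Real.exp (α * k / m) else 0) ∧
      ∑' k : ℤ, (if k < a ∨ b ≤ k then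
        min 1 (Real.exp (β * (x - k / m))) * Real.exp (α * k / m) else 0) ≤
        (1 + m / α) * Real.exp (α * y) +
          (1 + m / (β - α)) * Real.exp (β * x - (β - α) * z) := by
  obtain ⟨s1, h1⟩ := tsum_exp_lt_le hm hα ha
  obtain ⟨s2, h2⟩ := tsum_exp_ge_le hm (sub_pos.2 hαβ) hb
  have s3 := s1.add (s2.mul_left (Real.exp (β * x)))
  have hle : ∀ k : ℤ, (if k < a ∨ b ≤ k then
        min 1 (Real.exp (β * (x - k / m))) * Real.exp (α * k / m) else 0) ≤
      (if k < a then Real.exp (α * k / m) else 0) +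
        Real.exp (β * x) * (if b ≤ k then Real.exp (-((β - α) * k / m)) else 0) := by
    intro k
    have e1 : min 1 (Real.exp (β * (x - k / m))) * Real.exp (α * k / m) ≤
        Real.exp (α * k / m) := mul_le_of_le_one_left (Real.exp_nonneg _) (min_le_left _ _)
    have e2 : min 1 (Real.exp (β * (x - k / m))) * Real.exp (α * k / m) ≤
        Real.exp (β * x) * Real.exp (-((β - α) * k / m)) := by
      calc _ ≤ Real.exp (β * (x - k / m)) * Real.exp (α * k / m) := by
            gcongr; exact min_le_right _ _
        _ = _ := by rw [← Real.exp_add, ← Real.exp_add]; ring_nf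
    by_cases c1 : k < a <;> by_cases c2 : b ≤ k <;> simp only [c1, c2, if_true, if_false, true_or,
      or_true, or_self, mul_zero, add_zero, zero_add, le_refl]
    · exact e1.trans (le_add_of_nonneg_right (by positivity))
    · exact e1
    · exact e2
  have hnn : ∀ k : ℤ, 0 ≤ (if k < a ∨ b ≤ k then
        min 1 (Real.exp (β * (x - k / m))) * Real.exp (α * k / m) else 0) := by
    intro k; positivity
  have s4 := Summable.of_nonneg_of_le hnn hle s3
  refine ⟨s4, (s4.tsum_le_tsum hle s3).trans ?_⟩
  rw [s1.tsum_add (s2.mul_left _), tsum_mul_left]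
  have : Real.exp (β * x) * ((1 + m / (β - α)) * Real.exp (-((β - α) * z))) =
      (1 + m / (β - α)) * Real.exp (β * x - (β - α) * z) := by
    rw [sub_eq_add_neg (β * x), Real.exp_add]; ring
  rw [← this]
  gcongr

lemma tsum_min_one_exp_le (hm : 1 ≤ m) {α β x : ℝ} (hα : 0 < α) (hαβ : α < β) :
    Summable (fun k : ℤ => min 1 (Real.exp (β * (x - k / m))) * Real.exp (α * k / m)) ∧
      ∑' k : ℤ, min 1 (Real.exp (β * (x - k / m))) * Real.exp (α * k / m) ≤
        (1 + m / α) * Real.exp (α * x) + (1 + m / (β - α)) * Real.exp (α * x) := by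
  have h := tsum_min_one_exp_tail_le (x := x) (y := x) (z := x) (a := ⌈m * x⌉) (b := ⌈m * x⌉)
    hm hα hαβ (by linarith [Int.ceil_lt_add_one (m * x)]) (Int.le_ceil _)
  have e : β * x - (β - α) * x = α * x := by ring
  simpa only [lt_or_ge, if_true, e] using h

end Tails

/-! ### Characters -/

section Char

variable {G : Type u} [AddCommGroup G] [TopologicalSpace G]

lemma norm_ch (x : G) (γ : CharGroup G) : ‖ch x γ‖ = 1 := Circle.norm_coe _

lemma ch_zero (γ : CharGroup G) : ch (0 : G) γ = 1 := by
  simp [ch]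

lemma norm_ch_sub_one_le (x : G) (γ : CharGroup G) : ‖ch x γ - 1‖ ≤ 2 := by
  calc ‖ch x γ - 1‖ ≤ ‖ch x γ‖ + ‖(1 : ℂ)‖ := norm_sub_le _ _
    _ = 2 := by rw [norm_ch, norm_one]; norm_num

lemma continuous_ch_left (γ : CharGroup G) : Continuous fun x : G => ch x γ :=
  (by fun_prop : Continuous ((↑) : Circle → ℂ)).comp ((map_continuous γ).comp continuous_ofAdd)

lemma continuous_ch_right (x : G) : Continuous fun γ : CharGroup G => ch x γ :=
  (by fun_prop : Continuous ((↑) : Circle → ℂ)).comp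
    ((ContinuousEvalConst.continuous_eval_const (F := Multiplicative G →ₜ* Circle)
      (Multiplicative.ofAdd x)))

variable [MeasurableSpace (CharGroup G)] [BorelSpace (CharGroup G)]

/-- Without second countability of `G` and its dual the pairing need not be measurable on
`G × CharGroup G`, but it becomes so along an almost everywhere strongly measurable `X`, which is a
pointwise limit of simple functions. -/
lemma aemeasurable_ch_comp {Ω T : Type*} [MeasurableSpace Ω] [MeasurableSpace T]
    {P : Measure Ω} {ν : Measure T} [SFinite P] [SFinite ν] {X : Ω → G}
    (hX : AEStronglyMeasurable X P) {τ : T → CharGroup G} (hτ : Measurable τ) :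
    AEMeasurable (fun z : Ω × T => ch (X z.1) (τ z.2)) (P.prod ν) := by
  obtain ⟨X', hX', hXX'⟩ := hX
  obtain ⟨s, hs⟩ := hX'
  have hm : Measurable (fun z : Ω × T => ch (X' z.1) (τ z.2)) := by
    refine measurable_of_tendsto_metrizable (f := fun n z => ch (s n z.1) (τ z.2)) (fun n => ?_) ?_
    · exact ((s n).comp Prod.fst measurable_fst).measurable_bind
        (fun x z => ch x (τ z.2)) fun x =>
          (continuous_ch_right x).measurable.comp (hτ.comp measurable_snd)
    · rw [tendsto_pi_nhds]
      intro z
      exact ((continuous_ch_left _).tendsto _).comp (hs z.1)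
  refine hm.aemeasurable.congr ?_
  filter_upwards [Measure.quasiMeasurePreserving_fst.ae hXX'] with z hz
  rw [hz]

end Char

/-! ### Weighted aggregations and their dominating variables -/

section Agg

variable {G : Type u} [AddCommGroup G]

/-- The random variable `∑ₖ 2wₖ 1{xₖ ≠ 0}`, which bounds `∑ₖ |(xₖ, γ) - 1| wₖ` for all characters
`γ` at once. -/
noncomputable def dominator (w : ℤ → ℝ) (x : ℤ → G) : ENNReal :=
  ∑' k, {y : G | y ≠ 0}.indicator (fun _ => ENNReal.ofReal (2 * w k)) (x k)

variable [TopologicalSpace G]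

/-- The aggregation `∑ₖ ((xₖ, γ) - 1) wₖ - κ` with general weights `wₖ` and offset `κ`; both the full
and the truncated aggregation have this form. -/
noncomputable def weightedAgg (w : ℤ → ℝ) (κ : ℝ) (x : ℤ → G) (γ : CharGroup G) : ℂ :=
  ∑' k, (ch (x k) γ - 1) * (w k : ℂ) - (κ : ℂ)

lemma enorm_term_le {w : ℤ → ℝ} (hw : ∀ k, 0 ≤ w k) (x : ℤ → G) (γ : CharGroup G) (k : ℤ) :
    ‖(ch (x k) γ - 1) * (w k : ℂ)‖ₑ ≤
      {y : G | y ≠ 0}.indicator (fun _ => ENNReal.ofReal (2 * w k)) (x k) := by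
  by_cases h : x k = 0
  · simp [h, ch_zero]
  · rw [Set.indicator_of_mem (by exact h), ← ofReal_norm, norm_mul, Complex.norm_real,
      Real.norm_of_nonneg (hw k)]
    gcongr
    · exact hw k
    · exact norm_ch_sub_one_le _ _

lemma summable_norm_term {w : ℤ → ℝ} (hw : ∀ k, 0 ≤ w k) {x : ℤ → G} (hx : dominator w x ≠ ⊤)
    (γ : CharGroup G) : Summable fun k => ‖(ch (x k) γ - 1) * (w k : ℂ)‖ := by
  have h := ENNReal.summable_toReal
    (ne_top_of_le_ne_top hx (ENNReal.tsum_le_tsum (enorm_term_le hw x γ)))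
  simpa using h

lemma norm_tsum_term_le {w : ℤ → ℝ} (hw : ∀ k, 0 ≤ w k) {x : ℤ → G} (hx : dominator w x ≠ ⊤)
    (γ : CharGroup G) : ‖∑' k, (ch (x k) γ - 1) * (w k : ℂ)‖ ≤ (dominator w x).toReal := by
  refine (norm_tsum_le_tsum_norm (summable_norm_term hw hx γ)).trans ?_
  have h1 : ∑' k, ‖(ch (x k) γ - 1) * (w k : ℂ)‖ₑ ≤ dominator w x :=
    ENNReal.tsum_le_tsum (enorm_term_le hw x γ)
  have h2 := ENNReal.toReal_mono hx h1
  rw [ENNReal.tsum_toReal_eq (fun k => enorm_ne_top)] at h2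
  simpa using h2

lemma norm_weightedAgg_le {w : ℤ → ℝ} (hw : ∀ k, 0 ≤ w k) {x : ℤ → G} (hx : dominator w x ≠ ⊤)
    (κ : ℝ) (γ : CharGroup G) :
    ‖weightedAgg w κ x γ‖ ≤ (dominator w x).toReal + |κ| := by
  refine (norm_sub_le _ _).trans ?_
  rw [Complex.norm_real, Real.norm_eq_abs]
  gcongr
  exact norm_tsum_term_le hw hx γ

lemma continuous_weightedAgg {w : ℤ → ℝ} (hw : ∀ k, 0 ≤ w k) {x : ℤ → G}
    (hx : dominator w x ≠ ⊤) (κ : ℝ) : Continuous (weightedAgg w κ x) := by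
  refine (continuous_tsum (u := fun k => ({y : G | y ≠ 0}.indicator
    (fun _ => ENNReal.ofReal (2 * w k)) (x k)).toReal) (fun k => ?_)
    (ENNReal.summable_toReal hx) fun k γ => ?_).sub continuous_const
  · exact ((continuous_ch_right _).sub continuous_const).mul continuous_const
  · have h := ENNReal.toReal_mono (ENNReal.ne_top_of_tsum_ne_top hx k) (enorm_term_le hw x γ k)
    simpa using h

variable [MeasurableSpace G] [BorelSpace G]

lemma measurable_weightedAgg (w : ℤ → ℝ) (κ : ℝ) (γ : CharGroup G) :
    Measurable fun x : ℤ → G => weightedAgg w κ x γ := by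
  refine Measurable.sub_const (Measurable.tsum fun k => ?_) _
  exact (((continuous_ch_left γ).measurable.comp (measurable_pi_apply k)).sub_const _).mul_const _

variable [T2Space G]

lemma measurableSet_ne_zero : MeasurableSet {y : G | y ≠ 0} :=
  (isClosed_singleton (x := (0 : G))).measurableSet.compl

lemma measurable_dominator (w : ℤ → ℝ) : Measurable (dominator w : (ℤ → G) → ENNReal) :=
  Measurable.tsum fun k =>
    (measurable_const.indicator measurableSet_ne_zero).comp (measurable_pi_apply k)

variable {Ω : Type v} [MeasurableSpace Ω] {P : Measure Ω}

/-- If `P(xₖ ≠ 0) ≤ pₖ`, the second moment of the dominating variable is at most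
`(∑ₖ 2wₖ √pₖ)²`, by Minkowski's inequality. -/
lemma lintegral_dominator_sq_le {w p : ℤ → ℝ} (hw : ∀ k, 0 ≤ w k)
    {x : ℤ → Ω → G} (hx : ∀ k, AEMeasurable (x k) P)
    (hp : ∀ k, P {ω | x k ω ≠ 0} ≤ ENNReal.ofReal (p k)) :
    ∫⁻ ω, dominator w (fun k => x k ω) ^ 2 ∂P ≤
      (∑' k, ENNReal.ofReal (2 * w k * √(p k))) ^ 2 := by
  set a : ℤ → Ω → ENNReal := fun k ω =>
    {y : G | y ≠ 0}.indicator (fun _ => ENNReal.ofReal (2 * w k)) (x k ω) with ha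
  have ham : ∀ k, AEMeasurable (a k) P := fun k =>
    (measurable_const.indicator measurableSet_ne_zero).comp_aemeasurable (hx k)
  have hint : ∀ k l, ∫⁻ ω, a k ω * a l ω ∂P ≤
      ENNReal.ofReal (2 * w k * √(p k)) * ENNReal.ofReal (2 * w l * √(p l)) := by
    intro k l
    have h1 : ∀ ω, a k ω * a l ω ≤ {ω | x k ω ≠ 0 ∧ x l ω ≠ 0}.indicator
        (fun _ => ENNReal.ofReal (2 * w k) * ENNReal.ofReal (2 * w l)) ω := by
      intro ω
      by_cases h1 : x k ω = 0
      · simp [ha, h1]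
      by_cases h2 : x l ω = 0
      · simp [ha, h2]
      simp [ha, h1, h2]
    have hk := hp k
    have hl := hp l
    -- the probability of an intersection is at most the geometric mean of the probabilities
    have h2 : P {ω | x k ω ≠ 0 ∧ x l ω ≠ 0} ≤ ENNReal.ofReal (√(p k) * √(p l)) := by
      have e1 : P {ω | x k ω ≠ 0 ∧ x l ω ≠ 0} ≤ ENNReal.ofReal (p k) :=
        (measure_mono fun ω h => h.1).trans hk
      have e2 : P {ω | x k ω ≠ 0 ∧ x l ω ≠ 0} ≤ ENNReal.ofReal (p l) :=
        (measure_mono fun ω h => h.2).trans hl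
      rcases le_total (p k) (p l) with h | h
      · refine e1.trans (ENNReal.ofReal_le_ofReal ?_)
        rcases le_or_gt (p k) 0 with h0 | h0
        · exact h0.trans (by positivity)
        · calc p k = √(p k) * √(p k) := (Real.mul_self_sqrt h0.le).symm
            _ ≤ _ := by gcongr
      · refine e2.trans (ENNReal.ofReal_le_ofReal ?_)
        rcases le_or_gt (p l) 0 with h0 | h0
        · exact h0.trans (by positivity)
        · calc p l = √(p l) * √(p l) := (Real.mul_self_sqrt h0.le).symm
            _ ≤ _ := by gcongr
    calc ∫⁻ ω, a k ω * a l ω ∂P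
        ≤ ∫⁻ ω, {ω | x k ω ≠ 0 ∧ x l ω ≠ 0}.indicator
          (fun _ => ENNReal.ofReal (2 * w k) * ENNReal.ofReal (2 * w l)) ω ∂P := lintegral_mono h1
      _ ≤ ENNReal.ofReal (2 * w k) * ENNReal.ofReal (2 * w l) *
          P {ω | x k ω ≠ 0 ∧ x l ω ≠ 0} := lintegral_indicator_const_le _ _
      _ ≤ ENNReal.ofReal (2 * w k) * ENNReal.ofReal (2 * w l) *
          ENNReal.ofReal (√(p k) * √(p l)) := by gcongr
      _ = _ := by
        have := hw k
        have := hw l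
        rw [← ENNReal.ofReal_mul (by positivity), ← ENNReal.ofReal_mul (by positivity),
          ← ENNReal.ofReal_mul (by positivity)]
        ring_nf
  calc ∫⁻ ω, dominator w (fun k => x k ω) ^ 2 ∂P
      = ∫⁻ ω, ∑' k, ∑' l, a k ω * a l ω ∂P := by
        refine lintegral_congr fun ω => ?_
        simp only [ENNReal.tsum_mul_left, ENNReal.tsum_mul_right, sq]
        rfl
    _ = ∑' k, ∑' l, ∫⁻ ω, a k ω * a l ω ∂P := by
        rw [lintegral_tsum (f := fun k ω => ∑' l, a k ω * a l ω)
          fun k => AEMeasurable.tsum fun l => (ham k).mul (ham l)]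
        exact tsum_congr fun k => lintegral_tsum fun l => (ham k).mul (ham l)
    _ ≤ ∑' k, ∑' l, ENNReal.ofReal (2 * w k * √(p k)) * ENNReal.ofReal (2 * w l * √(p l)) :=
        ENNReal.tsum_le_tsum fun k => ENNReal.tsum_le_tsum fun l => hint k l
    _ = _ := by simp only [ENNReal.tsum_mul_left, ENNReal.tsum_mul_right, sq]

lemma lintegral_dominator_sq_lt_top {w p : ℤ → ℝ} (hw : ∀ k, 0 ≤ w k)
    (hs : Summable fun k => w k * √(p k)) {x : ℤ → Ω → G} (hx : ∀ k, AEMeasurable (x k) P)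
    (hp : ∀ k, P {ω | x k ω ≠ 0} ≤ ENNReal.ofReal (p k)) :
    ∫⁻ ω, dominator w (fun k => x k ω) ^ 2 ∂P < ⊤ := by
  refine (lintegral_dominator_sq_le hw hx hp).trans_lt (ENNReal.pow_lt_top ?_)
  have h : Summable fun k => 2 * w k * √(p k) := by simpa only [mul_assoc] using hs.mul_left 2
  exact h.tsum_ofReal_lt_top

lemma aemeasurable_dominator (w : ℤ → ℝ) {x : ℤ → Ω → G} (hx : ∀ k, AEMeasurable (x k) P) :
    AEMeasurable (fun ω => dominator w fun k => x k ω) P :=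
  (measurable_dominator w).comp_aemeasurable (aemeasurable_pi_iff.2 hx)

lemma ae_dominator_ne_top {w p : ℤ → ℝ} (hw : ∀ k, 0 ≤ w k)
    (hs : Summable fun k => w k * √(p k)) {x : ℤ → Ω → G} (hx : ∀ k, AEMeasurable (x k) P)
    (hp : ∀ k, P {ω | x k ω ≠ 0} ≤ ENNReal.ofReal (p k)) :
    ∀ᵐ ω ∂P, dominator w (fun k => x k ω) ≠ ⊤ := by
  filter_upwards [ae_lt_top' ((aemeasurable_dominator w hx).pow_const 2)
    (lintegral_dominator_sq_lt_top hw hs hx hp).ne] with ω hω h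
  simp [h] at hω

lemma memLp_dominator {w p : ℤ → ℝ} (hw : ∀ k, 0 ≤ w k)
    (hs : Summable fun k => w k * √(p k)) {x : ℤ → Ω → G} (hx : ∀ k, AEMeasurable (x k) P)
    (hp : ∀ k, P {ω | x k ω ≠ 0} ≤ ENNReal.ofReal (p k)) :
    MemLp (fun ω => (dominator w fun k => x k ω).toReal) 2 P := by
  refine ⟨(aemeasurable_dominator w hx).ennreal_toReal.aestronglyMeasurable, ?_⟩
  rw [eLpNorm_lt_top_iff_lintegral_rpow_enorm_lt_top (by norm_num) (by norm_num)]
  refine lt_of_le_of_lt (lintegral_mono fun ω => ?_)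
    (lintegral_dominator_sq_lt_top hw hs hx hp)
  simp only [ENNReal.toReal_ofNat, ENNReal.rpow_ofNat]
  gcongr
  rw [Real.enorm_of_nonneg ENNReal.toReal_nonneg]
  exact ENNReal.ofReal_toReal_le

end Agg

/-! ### Independence of blocks of random variables -/

section Indep

variable {Ω : Type v} [MeasurableSpace Ω] {P : Measure Ω}

/-- Grouping independent random variables into disjoint blocks gives independent blocks. -/
lemma iIndepFun_curry {ι κ E : Type*} [Countable ι] [Countable κ] [MeasurableSpace E]
    {X : ι → κ → Ω → E} (hX : ∀ i j, AEMeasurable (X i j) P)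
    (h : iIndepFun (fun i : ι × κ => X i.1 i.2) P) :
    iIndepFun (fun (i : ι) (ω : Ω) (j : κ) => X i j ω) P := by
  have hP := h.isProbabilityMeasure
  have hprob : ∀ i j, IsProbabilityMeasure (P.map (X i j)) :=
    fun i j => Measure.isProbabilityMeasure_map (hX i j)
  have hX1 : ∀ i, AEMeasurable (fun ω j => X i j ω) P := fun i => aemeasurable_pi_iff.2 (hX i)
  rw [iIndepFun_iff_map_fun_eq_infinitePi_map₀' hX1]
  have hjoint := h.map_fun_eq_infinitePi_map₀' fun i : ι × κ => hX i.1 i.2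
  have hrow : ∀ i, P.map (fun ω j => X i j ω) = Measure.infinitePi fun j => P.map (X i j) :=
    fun i => (h.precomp (g := fun j => (i, j))
      (Prod.mk_right_injective i)).map_fun_eq_infinitePi_map₀' (hX i)
  simp only [hrow]
  rw [← Measure.infinitePi_map_curry (fun i j => P.map (X i j)), ← hjoint,
    AEMeasurable.map_map_of_aemeasurable (MeasurableEquiv.measurable _).aemeasurable
      (aemeasurable_pi_iff.2 fun i : ι × κ => hX i.1 i.2)]
  rfl

lemma lintegral_prod_of_iIndepFun {ι : Type*} (s : Finset ι) {Y : ι → Ω → ENNReal}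
    (hY : iIndepFun Y P) (hm : ∀ i, AEMeasurable (Y i) P) :
    ∫⁻ ω, ∏ i ∈ s, Y i ω ∂P = ∏ i ∈ s, ∫⁻ ω, Y i ω ∂P := by
  have h1 := lintegral_prod_eq_prod_lintegral_of_indepFun s (fun i => (hm i).mk (Y i))
    (hY.congr fun i => (hm i).ae_eq_mk) fun i => (hm i).measurable_mk
  have h2 : ∀ᵐ ω ∂P, ∀ i ∈ s, Y i ω = (hm i).mk (Y i) ω :=
    (s.eventually_all).2 fun i _ => (hm i).ae_eq_mk
  rw [lintegral_congr_ae (g := fun ω => ∏ i ∈ s, (hm i).mk (Y i) ω), h1]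
  · exact Finset.prod_congr rfl fun i _ => lintegral_congr_ae (hm i).ae_eq_mk.symm
  · filter_upwards [h2] with ω hω
    exact Finset.prod_congr rfl hω

end Indep

/-! ### First and second moments in a single tower -/

section SingleTower

variable {G : Type u} [AddCommGroup G] [TopologicalSpace G] [MeasurableSpace G]
  {Ω : Type v} [MeasurableSpace Ω]

/-- The mean of `(X, γ) - 1`. -/
noncomputable def cellMean (P : Measure Ω) (X : Ω → G) (γ : CharGroup G) : ℂ :=
  ∫ ω, (ch (X ω) γ - 1) ∂P

/-- The covariance of `(X, γ)` and `(X, γ')`, computed from the variables `(X, ·) - 1`, which vanish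
where `X = 0`. -/
noncomputable def cellCov (P : Measure Ω) (X : Ω → G) (γ γ' : CharGroup G) : ℂ :=
  ∫ ω, (ch (X ω) γ - 1) * (starRingEnd ℂ) (ch (X ω) γ' - 1) ∂P -
    cellMean P X γ * (starRingEnd ℂ) (cellMean P X γ')

variable [BorelSpace G] {P : Measure Ω}

lemma aemeasurable_ch_sub_one {X : Ω → G} (hX : AEMeasurable X P) (γ : CharGroup G) :
    AEMeasurable (fun ω => ch (X ω) γ - 1) P :=
  ((continuous_ch_left γ).measurable.comp_aemeasurable hX).sub_const _

variable {w : ℤ → ℝ} {x : ℤ → Ω → G}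

lemma aemeasurable_weightedAgg (hx : ∀ k, AEMeasurable (x k) P) (κ : ℝ) (γ : CharGroup G) :
    AEMeasurable (fun ω => weightedAgg w κ (fun k => x k ω) γ) P :=
  (measurable_weightedAgg w κ γ).comp_aemeasurable (aemeasurable_pi_iff.2 hx)

variable [T2Space G]

/-- Functions of a cell that vanish where the cell does have means of order `P(X ≠ 0)`. -/
lemma norm_integral_le_of_ne_zero [IsFiniteMeasure P] {X : Ω → G} (hX : AEMeasurable X P)
    {p c : ℝ} (hp0 : 0 ≤ p) (hp : P {ω | X ω ≠ 0} ≤ ENNReal.ofReal p) (hc : 0 ≤ c) {h : Ω → ℂ}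
    (h0 : ∀ ω, X ω = 0 → h ω = 0) (hle : ∀ ω, ‖h ω‖ ≤ c) : ‖∫ ω, h ω ∂P‖ ≤ c * p := by
  have hm : NullMeasurableSet {ω | X ω ≠ 0} P := hX.nullMeasurable measurableSet_ne_zero
  have hb : ∀ ω, ‖h ω‖ ≤ {ω | X ω ≠ 0}.indicator (fun _ => c) ω := by
    intro ω
    by_cases hω : X ω = 0
    · simp [hω, h0 ω hω]
    · simpa [hω] using hle ω
  calc ‖∫ ω, h ω ∂P‖ ≤ ∫ ω, {ω | X ω ≠ 0}.indicator (fun _ => c) ω ∂P :=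
        norm_integral_le_of_norm_le ((integrable_const c).indicator₀ hm) (ae_of_all _ hb)
    _ = P.real {ω | X ω ≠ 0} * c := by
        rw [integral_indicator₀ hm, setIntegral_const, smul_eq_mul]
    _ ≤ p * c := by
        gcongr
        exact ENNReal.toReal_le_of_le_ofReal hp0 hp
    _ = c * p := mul_comm _ _

lemma norm_cellMean_le [IsFiniteMeasure P] {X : Ω → G} (hX : AEMeasurable X P) {p : ℝ}
    (hp0 : 0 ≤ p) (hp : P {ω | X ω ≠ 0} ≤ ENNReal.ofReal p) (γ : CharGroup G) :
    ‖cellMean P X γ‖ ≤ 2 * p :=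
  norm_integral_le_of_ne_zero hX hp0 hp zero_le_two (fun ω h => by simp [h, ch_zero])
    fun ω => norm_ch_sub_one_le _ _

lemma norm_cellCov_le [IsFiniteMeasure P] {X : Ω → G} (hX : AEMeasurable X P) {p : ℝ}
    (hp0 : 0 ≤ p) (hp1 : p ≤ 1) (hp : P {ω | X ω ≠ 0} ≤ ENNReal.ofReal p) (γ γ' : CharGroup G) :
    ‖cellCov P X γ γ'‖ ≤ 8 * p := by
  have h1 := norm_integral_le_of_ne_zero hX hp0 hp (c := 4) (by norm_num)
    (h := fun ω => (ch (X ω) γ - 1) * (starRingEnd ℂ) (ch (X ω) γ' - 1))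
    (fun ω h => by simp [h, ch_zero]) fun ω => by
      rw [norm_mul, RCLike.norm_conj]
      calc _ ≤ (2 : ℝ) * 2 := by gcongr <;> exact norm_ch_sub_one_le _ _
        _ = 4 := by norm_num
  have h2 : ‖cellMean P X γ * (starRingEnd ℂ) (cellMean P X γ')‖ ≤ 4 * p := by
    rw [norm_mul, RCLike.norm_conj]
    calc _ ≤ (2 * p) * (2 * p) := by gcongr <;> exact norm_cellMean_le hX hp0 hp _
      _ ≤ 4 * p := by nlinarith
  calc _ ≤ _ := norm_sub_le _ _
    _ ≤ 8 * p := by linarith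

variable {p : ℤ → ℝ} [IsProbabilityMeasure P]

lemma memLp_weightedAgg (hw : ∀ k, 0 ≤ w k) (hs : Summable fun k => w k * √(p k))
    (hx : ∀ k, AEMeasurable (x k) P) (hp : ∀ k, P {ω | x k ω ≠ 0} ≤ ENNReal.ofReal (p k))
    (κ : ℝ) (γ : CharGroup G) :
    MemLp (fun ω => weightedAgg w κ (fun k => x k ω) γ) 2 P := by
  refine ((memLp_dominator hw hs hx hp).add (memLp_const |κ|)).mono'
    (aemeasurable_weightedAgg hx κ γ).aestronglyMeasurable ?_
  filter_upwards [ae_dominator_ne_top hw hs hx hp] with ω hω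
  exact norm_weightedAgg_le hw hω κ γ

lemma integral_weightedAgg (hw : ∀ k, 0 ≤ w k) (hs : Summable fun k => w k * √(p k))
    (hx : ∀ k, AEMeasurable (x k) P) (hp : ∀ k, P {ω | x k ω ≠ 0} ≤ ENNReal.ofReal (p k))
    (κ : ℝ) (γ : CharGroup G) :
    ∫ ω, weightedAgg w κ (fun k => x k ω) γ ∂P = ∑' k, cellMean P (x k) γ * (w k : ℂ) - κ := by
  have hm : ∀ k, AEMeasurable (fun ω => (ch (x k ω) γ - 1) * (w k : ℂ)) P :=
    fun k => (aemeasurable_ch_sub_one (hx k) γ).mul_const _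
  have hfin : ∑' k, ∫⁻ ω, ‖(ch (x k ω) γ - 1) * (w k : ℂ)‖ₑ ∂P ≠ ⊤ := by
    rw [← lintegral_tsum fun k => (hm k).enorm]
    -- a square integrable `D` is integrable, as `D ≤ 1 + D²`
    refine ne_top_of_le_ne_top (b := ∫⁻ ω, (1 + dominator w (fun k => x k ω) ^ 2) ∂P) ?_
      (lintegral_mono fun ω => ?_)
    · rw [lintegral_add_left measurable_const]
      simpa using (lintegral_dominator_sq_lt_top hw hs hx hp).ne
    · refine (ENNReal.tsum_le_tsum (enorm_term_le hw (fun k => x k ω) γ)).trans ?_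
      change dominator w (fun k => x k ω) ≤ _
      rcases le_total (dominator w fun k => x k ω) 1 with h | h
      · exact h.trans le_self_add
      · exact (le_self_pow h two_ne_zero).trans le_add_self
  have hint : Integrable (fun ω => ∑' k, (ch (x k ω) γ - 1) * (w k : ℂ)) P := by
    have := (memLp_weightedAgg hw hs hx hp 0 γ).integrable one_le_two
    simpa [weightedAgg] using this
  simp only [weightedAgg]
  rw [integral_sub hint (integrable_const _), integral_const,
    integral_tsum (fun k => (hm k).aestronglyMeasurable) hfin]
  simp only [cellMean, integral_mul_const, probReal_univ, one_smul]

/-- The aggregation has covariance `∑ₖ wₖ² Cov((xₖ, γ), (xₖ, γ'))`: distinct cells are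
independent. -/
lemma integral_weightedAgg_mul_conj (hw : ∀ k, 0 ≤ w k) (hs : Summable fun k => w k * √(p k))
    (hx : ∀ k, AEMeasurable (x k) P) (hp : ∀ k, P {ω | x k ω ≠ 0} ≤ ENNReal.ofReal (p k))
    (hp0 : ∀ k, 0 ≤ p k) (hwp : Summable fun k => w k * p k)
    (hp1 : ∀ k, p k ≤ 1) (hwp2 : Summable fun k => w k ^ 2 * p k)
    (hind : iIndepFun x P) (κ : ℝ) (γ γ' : CharGroup G) :
    ∫ ω, weightedAgg w κ (fun k => x k ω) γ *
        (starRingEnd ℂ) (weightedAgg w κ (fun k => x k ω) γ') ∂P =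
      ∑' k, cellCov P (x k) γ γ' * (w k : ℂ) ^ 2 +
        (∑' k, cellMean P (x k) γ * (w k : ℂ) - κ) *
          (starRingEnd ℂ) (∑' k, cellMean P (x k) γ' * (w k : ℂ) - κ) := by
  set t : CharGroup G → ℤ → Ω → ℂ := fun γ k ω => (ch (x k ω) γ - 1) * (w k : ℂ) with ht
  have hm : ∀ γ k, AEMeasurable (t γ k) P :=
    fun γ k => (aemeasurable_ch_sub_one (hx k) γ).mul_const _
  set F : ℤ × ℤ → Ω → ℂ := fun z ω => t γ z.1 ω * (starRingEnd ℂ) (t γ' z.2 ω) with hF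
  have hFm : ∀ z, AEMeasurable (F z) P := fun z =>
    (hm γ z.1).mul (Complex.continuous_conj.measurable.comp_aemeasurable (hm γ' z.2))
  have hfin : ∑' z, ∫⁻ ω, ‖F z ω‖ₑ ∂P ≠ ⊤ := by
    rw [← lintegral_tsum fun z => (hFm z).enorm]
    refine ne_top_of_le_ne_top (lintegral_dominator_sq_lt_top hw hs hx hp).ne
      (lintegral_mono fun ω => ?_)
    have : ∀ z, ‖F z ω‖ₑ = ‖t γ z.1 ω‖ₑ * ‖t γ' z.2 ω‖ₑ := fun z => by
      simp [hF, enorm_eq_nnnorm]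
    simp only [this]
    rw [ENNReal.tsum_prod (f := fun k l => ‖t γ k ω‖ₑ * ‖t γ' l ω‖ₑ)]
    simp only [ENNReal.tsum_mul_left, ENNReal.tsum_mul_right]
    rw [sq]
    exact mul_le_mul' (ENNReal.tsum_le_tsum (enorm_term_le hw (fun k => x k ω) γ))
      (ENNReal.tsum_le_tsum (enorm_term_le hw (fun k => x k ω) γ'))
  have hdn : ∀ γ, Summable fun k => ‖cellMean P (x k) γ * (w k : ℂ)‖ := fun γ => by
    refine Summable.of_nonneg_of_le (fun k => norm_nonneg _) (fun k => ?_) (hwp.mul_left 2)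
    rw [norm_mul, Complex.norm_real, Real.norm_of_nonneg (hw k)]
    calc _ ≤ 2 * p k * w k := by
          gcongr
          · exact hw k
          · exact norm_cellMean_le (hx k) (hp0 k) (hp k) γ
      _ = _ := by ring
  have hcs : Summable fun k => cellCov P (x k) γ γ' * (w k : ℂ) ^ 2 := by
    refine Summable.of_norm_bounded (hwp2.mul_left 8) fun k => ?_
    rw [norm_mul, norm_pow, Complex.norm_real, Real.norm_of_nonneg (hw k)]
    calc _ ≤ 8 * p k * w k ^ 2 := by
          gcongr
          exact norm_cellCov_le (hx k) (hp0 k) (hp1 k) (hp k) γ γ'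
      _ = _ := by ring
  -- the mixed moments of two cells
  have hcell : ∀ z, ∫ ω, F z ω ∂P =
      (cellMean P (x z.1) γ * (w z.1 : ℂ)) * (starRingEnd ℂ) (cellMean P (x z.2) γ' * (w z.2 : ℂ)) +
        if z.1 = z.2 then cellCov P (x z.1) γ γ' * (w z.1 : ℂ) ^ 2 else 0 := by
    rintro ⟨k, l⟩
    have e1 : ∫ ω, F (k, l) ω ∂P = (∫ ω, (ch (x k ω) γ - 1) *
        (starRingEnd ℂ) (ch (x l ω) γ' - 1) ∂P) * ((w k : ℂ) * (w l : ℂ)) := by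
      rw [← integral_mul_const]
      refine integral_congr_ae (ae_of_all _ fun ω => ?_)
      simp only [hF, ht, map_mul, Complex.conj_ofReal]
      ring
    rw [e1]
    by_cases hkl : k = l
    · subst hkl
      simp only [if_true, cellCov, map_mul, Complex.conj_ofReal]
      ring
    · have hi := (hind.indepFun hkl).integral_fun_comp_mul_comp
        (f := fun y => ch y γ - 1) (g := fun y => (starRingEnd ℂ) (ch y γ' - 1)) (hx k) (hx l)
        ((continuous_ch_left γ).measurable.sub_const _).aestronglyMeasurable
        (Complex.continuous_conj.measurable.comp
          ((continuous_ch_left γ').measurable.sub_const _)).aestronglyMeasurable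
      rw [hi, integral_conj]
      simp only [hkl, if_false, cellMean, map_mul, Complex.conj_ofReal]
      ring
  have hdiag : HasSum (fun z : ℤ × ℤ => if z.1 = z.2 then
      cellCov P (x z.1) γ γ' * (w z.1 : ℂ) ^ 2 else 0)
      (∑' k, cellCov P (x k) γ γ' * (w k : ℂ) ^ 2) := by
    have hinj : Function.Injective fun k : ℤ => (k, k) := fun k l h => (Prod.mk.inj h).1
    rw [← hinj.hasSum_iff]
    · simpa [Function.comp_def] using hcs.hasSum
    · rintro ⟨k, l⟩ hkl
      have : k ≠ l := fun h => hkl ⟨k, by simp [h]⟩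
      simp [this]
  have hdn' : Summable fun k => ‖(starRingEnd ℂ) (cellMean P (x k) γ' * (w k : ℂ))‖ := by
    simpa only [RCLike.norm_conj] using hdn γ'
  have hmain : ∫ ω, (∑' k, t γ k ω) * (starRingEnd ℂ) (∑' k, t γ' k ω) ∂P =
      ∑' k, cellCov P (x k) γ γ' * (w k : ℂ) ^ 2 + (∑' k, cellMean P (x k) γ * (w k : ℂ)) *
          (starRingEnd ℂ) (∑' k, cellMean P (x k) γ' * (w k : ℂ)) := by
    have e1 : ∫ ω, (∑' k, t γ k ω) * (starRingEnd ℂ) (∑' k, t γ' k ω) ∂P =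
        ∫ ω, ∑' z, F z ω ∂P := by
      refine integral_congr_ae ?_
      filter_upwards [ae_dominator_ne_top hw hs hx hp] with ω hω
      rw [Complex.conj_tsum]
      refine tsum_mul_tsum_of_summable_norm (summable_norm_term hw hω γ) ?_
      simpa only [RCLike.norm_conj] using summable_norm_term hw hω γ'
    rw [e1, integral_tsum (fun z => (hFm z).aestronglyMeasurable) hfin, tsum_congr hcell,
      Summable.tsum_add (summable_mul_of_summable_norm (hdn γ) hdn') hdiag.summable, hdiag.tsum_eq,
      ← tsum_mul_tsum_of_summable_norm (hdn γ) hdn', Complex.conj_tsum, add_comm]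
  have hL : ∀ γ, MemLp (fun ω => ∑' k, t γ k ω) 2 P := fun γ => by
    have := memLp_weightedAgg hw hs hx hp 0 γ
    simpa [weightedAgg] using this
  have hI : ∀ γ, Integrable (fun ω => ∑' k, t γ k ω) P := fun γ => (hL γ).integrable one_le_two
  have hI' : Integrable (fun ω => (starRingEnd ℂ) (∑' k, t γ' k ω)) P :=
    (Complex.conjLIE.toContinuousLinearEquiv : ℂ →L[ℝ] ℂ).integrable_comp (hI γ')
  have hII : Integrable (fun ω => (∑' k, t γ k ω) * (starRingEnd ℂ) (∑' k, t γ' k ω)) P := by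
    have h' : MemLp (fun ω => (starRingEnd ℂ) (∑' k, t γ' k ω)) 2 P :=
      (hL γ').of_le hI'.1 (ae_of_all _ fun ω => (RCLike.norm_conj _).le)
    exact (hL γ).integrable_mul h'
  have hEm : ∀ γ, ∫ ω, ∑' k, t γ k ω ∂P = ∑' k, cellMean P (x k) γ * (w k : ℂ) := fun γ => by
    have := integral_weightedAgg hw hs hx hp 0 γ
    simpa [weightedAgg] using this
  have hexp : ∀ ω, weightedAgg w κ (fun k => x k ω) γ *
        (starRingEnd ℂ) (weightedAgg w κ (fun k => x k ω) γ') =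
      (∑' k, t γ k ω) * (starRingEnd ℂ) (∑' k, t γ' k ω) - (κ : ℂ) * ∑' k, t γ k ω -
        (κ : ℂ) * (starRingEnd ℂ) (∑' k, t γ' k ω) + (κ : ℂ) * κ := fun ω => by
    simp only [weightedAgg, map_sub, Complex.conj_ofReal, ht]
    ring
  have i1 : Integrable (fun ω => (κ : ℂ) * ∑' k, t γ k ω) P := (hI γ).const_mul _
  have i2 : Integrable (fun ω => (κ : ℂ) * (starRingEnd ℂ) (∑' k, t γ' k ω)) P := hI'.const_mul _
  have i3 : Integrable (fun ω => (∑' k, t γ k ω) * (starRingEnd ℂ) (∑' k, t γ' k ω) -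
      (κ : ℂ) * ∑' k, t γ k ω) P := hII.sub i1
  have i4 : Integrable (fun ω => (∑' k, t γ k ω) * (starRingEnd ℂ) (∑' k, t γ' k ω) -
      (κ : ℂ) * ∑' k, t γ k ω - (κ : ℂ) * (starRingEnd ℂ) (∑' k, t γ' k ω)) P := i3.sub i2
  rw [integral_congr_ae (ae_of_all _ hexp), integral_add i4 (integrable_const _),
    integral_sub i3 i2, integral_sub hII i1, hmain, integral_const_mul, integral_const_mul,
    integral_conj, hEm, hEm, integral_const]
  simp only [map_sub, Complex.conj_ofReal, probReal_univ, one_smul]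
  ring

end SingleTower

/-! ### First and second moments of the estimators -/

section Estimators

/-- Nonnegative weights `w` for which the aggregation of cells that are nonzero with probabilities
at most `p` converges in `L²`. -/
structure AdmissibleWeights (p w : ℤ → ℝ) : Prop where
  nonneg : ∀ k, 0 ≤ w k
  summable_sqrt : Summable fun k => w k * √(p k)
  summable_sq : Summable fun k => w k ^ 2 * p k

variable {G : Type u} [AddCommGroup G] [TopologicalSpace G]
  {Ω : Type v} [MeasurableSpace Ω]

/-- The estimator built from weighted aggregations, for a finite measure `ρ` on the character group
and a bounded density `g`. -/
noncomputable def weightedEst [MeasurableSpace (CharGroup G)] (ρ : Measure (CharGroup G))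
    (g : CharGroup G → ℂ) (w : ℤ → ℝ) (κ : ℝ) (x : Fin 3 → ℤ → G) : ℂ :=
  ∫ γ, g γ * ∏ j, weightedAgg w κ (x j) γ ∂ρ

/-- A bound for the product of the three aggregations, uniform in the character. -/
noncomputable def towerDominator (w : ℤ → ℝ) (κ : ℝ) (x : Fin 3 → ℤ → G) : ℝ :=
  ∏ j, ((dominator w (x j)).toReal + |κ|)

lemma norm_prod_weightedAgg_le {p w : ℤ → ℝ} (hw : AdmissibleWeights p w) {x : Fin 3 → ℤ → G}
    (hx : ∀ j, dominator w (x j) ≠ ⊤) (κ : ℝ) (γ : CharGroup G) :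
    ‖∏ j, weightedAgg w κ (x j) γ‖ ≤ towerDominator w κ x := by
  rw [norm_prod]
  exact Finset.prod_le_prod (fun j _ => norm_nonneg _)
    fun j _ => norm_weightedAgg_le hw.nonneg (hx j) κ γ

lemma integrable_weightedEst [MeasurableSpace (CharGroup G)] [BorelSpace (CharGroup G)]
    {ρ : Measure (CharGroup G)} [IsFiniteMeasure ρ] {g : CharGroup G → ℂ} {p w : ℤ → ℝ}
    (hg : AEMeasurable g ρ) (hg1 : ∀ γ, ‖g γ‖ ≤ 1)
    (hw : AdmissibleWeights p w) {x : Fin 3 → ℤ → G} (hx : ∀ j, dominator w (x j) ≠ ⊤) (κ : ℝ) :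
    Integrable (fun γ => g γ * ∏ j, weightedAgg w κ (x j) γ) ρ := by
  refine (integrable_const (towerDominator w κ x)).mono'
    (hg.mul (continuous_finsetProd _ fun j _ =>
      continuous_weightedAgg hw.nonneg (hx j) κ).measurable.aemeasurable).aestronglyMeasurable
    (ae_of_all _ fun γ => ?_)
  rw [norm_mul]
  exact (mul_le_of_le_one_left (norm_nonneg _) (hg1 γ)).trans
    (norm_prod_weightedAgg_le hw hx κ γ)

variable [MeasurableSpace G]

/-- Three towers of jointly independent cells, cell `k` of each tower being nonzero with
probability at most `p k`. Both measurability conditions are required, because `G` need not be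
metrizable. This is all that the comparison of the two estimators uses. -/
structure IsSparseTower (P : Measure Ω) (p : ℤ → ℝ) (X : Fin 3 → ℤ → Ω → G) : Prop where
  nonneg : ∀ k, 0 ≤ p k
  le_one : ∀ k, p k ≤ 1
  aestronglyMeasurable : ∀ j k, AEStronglyMeasurable (X j k) P
  aemeasurable : ∀ j k, AEMeasurable (X j k) P
  indep : iIndepFun (fun i : Fin 3 × ℤ => X i.1 i.2) P
  measure_ne_zero_le : ∀ j k, P {ω | X j k ω ≠ 0} ≤ ENNReal.ofReal (p k)

/-- The mean of a weighted aggregation, as a series of means of cells; see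
`integral_weightedAgg`. -/
noncomputable def aggMean (P : Measure Ω) (w : ℤ → ℝ) (κ : ℝ) (x : ℤ → Ω → G) (γ : CharGroup G) :
    ℂ :=
  ∑' k, cellMean P (x k) γ * (w k : ℂ) - κ

/-- The covariance of a weighted aggregation at two characters, as a series of covariances of cells;
see `integral_weightedAgg_mul_conj`. -/
noncomputable def aggCov (P : Measure Ω) (w : ℤ → ℝ) (x : ℤ → Ω → G) (γ γ' : CharGroup G) : ℂ :=
  ∑' k, cellCov P (x k) γ γ' * (w k : ℂ) ^ 2

variable {P : Measure Ω} {p w : ℤ → ℝ} {X : Fin 3 → ℤ → Ω → G}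

lemma IsSparseTower.iIndepFun_path (hX : IsSparseTower P p X) :
    iIndepFun (fun (j : Fin 3) (ω : Ω) (k : ℤ) => X j k ω) P :=
  iIndepFun_curry hX.aemeasurable hX.indep

lemma IsSparseTower.aemeasurable_path (hX : IsSparseTower P p X) (j : Fin 3) :
    AEMeasurable (fun (ω : Ω) (k : ℤ) => X j k ω) P :=
  aemeasurable_pi_iff.2 (hX.aemeasurable j)

lemma IsSparseTower.iIndepFun_tower (hX : IsSparseTower P p X) (j : Fin 3) :
    iIndepFun (X j) P :=
  hX.indep.precomp (g := fun k => (j, k)) (Prod.mk_right_injective j)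

lemma AdmissibleWeights.summable_mul (hw : AdmissibleWeights p w) (hX : IsSparseTower P p X) :
    Summable fun k => w k * p k := by
  refine Summable.of_nonneg_of_le (fun k => mul_nonneg (hw.nonneg k) (hX.nonneg k)) (fun k => ?_)
    hw.summable_sqrt
  have := hw.nonneg k
  gcongr
  exact Real.le_sqrt_self_iff.2 (hX.le_one k)

lemma IsSparseTower.aemeasurable_prod_weightedAgg [SFinite P]
    [MeasurableSpace (CharGroup G)] [BorelSpace (CharGroup G)] (hX : IsSparseTower P p X)
    (w : ℤ → ℝ) (κ : ℝ) {T : Type*} [MeasurableSpace T] {ν : Measure T} [SFinite ν]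
    {τ : T → CharGroup G}
    (hτ : Measurable τ) :
    AEMeasurable (fun z : Ω × T => ∏ j, weightedAgg w κ (fun k => X j k z.1) (τ z.2))
      (P.prod ν) := by
  refine Finset.aemeasurable_fun_prod _ fun j _ => AEMeasurable.sub_const
    (AEMeasurable.tsum fun k => ?_) _
  exact ((aemeasurable_ch_comp (hX.aestronglyMeasurable j k) hτ).sub_const _).mul_const _

variable [BorelSpace G] [T2Space G]

lemma IsSparseTower.ae_dominator_ne_top (hX : IsSparseTower P p X) (hw : AdmissibleWeights p w) :
    ∀ᵐ ω ∂P, ∀ j, dominator w (fun k => X j k ω) ≠ ⊤ :=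
  ae_all_iff.2 fun j => PoissonTower.ae_dominator_ne_top hw.nonneg hw.summable_sqrt
    (hX.aemeasurable j) (hX.measure_ne_zero_le j)

variable [IsProbabilityMeasure P]

/-- The product of the three dominating variables is square integrable, because the towers are
independent. -/
lemma IsSparseTower.memLp_towerDominator (hX : IsSparseTower P p X) (hw : AdmissibleWeights p w)
    (κ : ℝ) : MemLp (fun ω => towerDominator w κ fun j k => X j k ω) 2 P := by
  have hD : ∀ j, MemLp (fun ω => (dominator w fun k => X j k ω).toReal + |κ|) 2 P := fun j =>
    (memLp_dominator hw.nonneg hw.summable_sqrt (hX.aemeasurable j)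
      (hX.measure_ne_zero_le j)).add (memLp_const |κ|)
  refine ⟨Finset.aestronglyMeasurable_fun_prod _ fun j _ => (hD j).1, ?_⟩
  rw [eLpNorm_lt_top_iff_lintegral_rpow_enorm_lt_top (by norm_num) (by norm_num)]
  have hmeas : Measurable fun x : ℤ → G => ‖(dominator w x).toReal + |κ|‖ₑ ^ (2 : ℝ) :=
    ((measurable_dominator w).ennreal_toReal.add_const _).enorm.pow_const _
  have hi := hX.iIndepFun_path.comp (fun _ => fun x => ‖(dominator w x).toReal + |κ|‖ₑ ^ (2 : ℝ))
    fun _ => hmeas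
  have h := lintegral_prod_of_iIndepFun Finset.univ hi
    fun j => hmeas.comp_aemeasurable (hX.aemeasurable_path j)
  have e : ∀ ω, ‖towerDominator w κ fun j k => X j k ω‖ₑ ^ (2 : ENNReal).toReal =
      ∏ j, ‖(dominator w fun k => X j k ω).toReal + |κ|‖ₑ ^ (2 : ℝ) := fun ω => by
    have he : ‖towerDominator w κ fun j k => X j k ω‖ₑ =
        ∏ j, ‖(dominator w fun k => X j k ω).toReal + |κ|‖ₑ := by
      simp [towerDominator, Fin.prod_univ_three, enorm_mul]
    rw [he, ENNReal.toReal_ofNat, ENNReal.prod_rpow_of_nonneg (by norm_num)]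
  simp only [Function.comp_def] at h
  rw [lintegral_congr e, h]
  refine ENNReal.prod_lt_top fun j _ => ?_
  have := (eLpNorm_lt_top_iff_lintegral_rpow_enorm_lt_top (by norm_num) (by norm_num)).1 (hD j).2
  simpa using this

lemma IsSparseTower.integral_prod_weightedAgg (hX : IsSparseTower P p X)
    (hw : AdmissibleWeights p w) (κ : ℝ) (γ : CharGroup G) :
    ∫ ω, ∏ j, weightedAgg w κ (fun k => X j k ω) γ ∂P = ∏ j, aggMean P w κ (X j) γ := by
  rw [hX.iIndepFun_path.integral_fun_prod_comp (f := fun _ x => weightedAgg w κ x γ)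
    hX.aemeasurable_path fun j => (measurable_weightedAgg w κ γ).aestronglyMeasurable]
  exact Finset.prod_congr rfl fun j _ => integral_weightedAgg hw.nonneg hw.summable_sqrt
    (hX.aemeasurable j) (hX.measure_ne_zero_le j) κ γ

lemma IsSparseTower.integral_prod_weightedAgg_mul_conj (hX : IsSparseTower P p X)
    (hw : AdmissibleWeights p w) (κ : ℝ) (γ γ' : CharGroup G) :
    ∫ ω, (∏ j, weightedAgg w κ (fun k => X j k ω) γ) *
        (starRingEnd ℂ) (∏ j, weightedAgg w κ (fun k => X j k ω) γ') ∂P =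
      ∏ j, (aggCov P w (X j) γ γ' +
        aggMean P w κ (X j) γ * (starRingEnd ℂ) (aggMean P w κ (X j) γ')) := by
  simp only [map_prod, ← Finset.prod_mul_distrib]
  rw [hX.iIndepFun_path.integral_fun_prod_comp
    (f := fun _ x => weightedAgg w κ x γ * (starRingEnd ℂ) (weightedAgg w κ x γ'))
    hX.aemeasurable_path fun j => ((measurable_weightedAgg w κ γ).mul
      (Complex.continuous_conj.measurable.comp
        (measurable_weightedAgg w κ γ'))).aestronglyMeasurable]
  exact Finset.prod_congr rfl fun j _ => integral_weightedAgg_mul_conj hw.nonneg hw.summable_sqrt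
    (hX.aemeasurable j) (hX.measure_ne_zero_le j) hX.nonneg (hw.summable_mul hX) hX.le_one
    hw.summable_sq (hX.iIndepFun_tower j) κ γ γ'

variable [MeasurableSpace (CharGroup G)] [BorelSpace (CharGroup G)]

variable {ρ : Measure (CharGroup G)} [IsFiniteMeasure ρ] {g : CharGroup G → ℂ}

lemma IsSparseTower.memLp_weightedEst (hX : IsSparseTower P p X) (hw : AdmissibleWeights p w)
    (hg : AEMeasurable g ρ) (hg1 : ∀ γ, ‖g γ‖ ≤ 1) (κ : ℝ) :
    MemLp (fun ω => weightedEst ρ g w κ fun j k => X j k ω) 2 P := by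
  refine ((hX.memLp_towerDominator hw κ).mul_const (ρ.real Set.univ)).mono' ?_ ?_
  · refine AEStronglyMeasurable.integral_prod_right'
      (f := fun z : Ω × CharGroup G => g z.2 * ∏ j, weightedAgg w κ (fun k => X j k z.1) z.2) ?_
    exact ((hg.comp_quasiMeasurePreserving Measure.quasiMeasurePreserving_snd).mul
      (hX.aemeasurable_prod_weightedAgg w κ measurable_id)).aestronglyMeasurable
  · filter_upwards [hX.ae_dominator_ne_top hw] with ω hω
    refine norm_integral_le_of_norm_le_const (ae_of_all _ fun γ => ?_)
    rw [norm_mul]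
    exact (mul_le_of_le_one_left (norm_nonneg _) (hg1 γ)).trans
      (norm_prod_weightedAgg_le hw hω κ γ)

lemma IsSparseTower.integrable_prod (hX : IsSparseTower P p X) (hw : AdmissibleWeights p w)
    (hg : AEMeasurable g ρ) (hg1 : ∀ γ, ‖g γ‖ ≤ 1) (κ : ℝ) :
    Integrable (fun z : Ω × CharGroup G =>
      g z.2 * ∏ j, weightedAgg w κ (fun k => X j k z.1) z.2) (P.prod ρ) := by
  refine (((hX.memLp_towerDominator hw κ).integrable one_le_two).comp_fst ρ).mono' ?_ ?_
  · exact ((hg.comp_quasiMeasurePreserving Measure.quasiMeasurePreserving_snd).mul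
      (hX.aemeasurable_prod_weightedAgg w κ measurable_id)).aestronglyMeasurable
  · filter_upwards [Measure.quasiMeasurePreserving_fst.ae (hX.ae_dominator_ne_top hw)] with z hz
    rw [norm_mul]
    exact (mul_le_of_le_one_left (norm_nonneg _) (hg1 _)).trans
      (norm_prod_weightedAgg_le hw hz κ _)

lemma IsSparseTower.integrable_aggMean (hX : IsSparseTower P p X) (hw : AdmissibleWeights p w)
    (hg : AEMeasurable g ρ) (hg1 : ∀ γ, ‖g γ‖ ≤ 1) (κ : ℝ) :
    Integrable (fun γ => g γ * ∏ j, aggMean P w κ (X j) γ) ρ := by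
  have h := (hX.integrable_prod hw hg hg1 κ).integral_prod_right
  simpa only [integral_const_mul, hX.integral_prod_weightedAgg hw] using h

lemma IsSparseTower.mean_weightedEst (hX : IsSparseTower P p X) (hw : AdmissibleWeights p w)
    (hg : AEMeasurable g ρ) (hg1 : ∀ γ, ‖g γ‖ ≤ 1) (κ : ℝ) :
    mean P (fun ω => weightedEst ρ g w κ fun j k => X j k ω) =
      ∫ γ, g γ * ∏ j, aggMean P w κ (X j) γ ∂ρ := by
  simp only [mean, weightedEst]
  rw [integral_integral_swap (hX.integrable_prod hw hg hg1 κ)]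
  simp only [integral_const_mul, hX.integral_prod_weightedAgg hw]

/-- Integrability of the second moment, written as an integral over the square of the character
group; it justifies exchanging this integral with the expectation. -/
lemma IsSparseTower.integrable_prod_mul_conj (hX : IsSparseTower P p X)
    (hw : AdmissibleWeights p w) (hg : AEMeasurable g ρ) (hg1 : ∀ γ, ‖g γ‖ ≤ 1) (κ : ℝ) :
    Integrable (fun q : Ω × CharGroup G × CharGroup G =>
      g q.2.1 * (starRingEnd ℂ) (g q.2.2) *
        ((∏ j, weightedAgg w κ (fun k => X j k q.1) q.2.1) *
          (starRingEnd ℂ) (∏ j, weightedAgg w κ (fun k => X j k q.1) q.2.2)))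
      (P.prod (ρ.prod ρ)) := by
  refine (((hX.memLp_towerDominator hw κ).integrable_sq).comp_fst (ρ.prod ρ)).mono' ?_ ?_
  · have h1 : AEMeasurable (fun z : CharGroup G × CharGroup G =>
        g z.1 * (starRingEnd ℂ) (g z.2)) (ρ.prod ρ) :=
      (hg.comp_quasiMeasurePreserving Measure.quasiMeasurePreserving_fst).mul
        (Complex.continuous_conj.measurable.comp_aemeasurable
          (hg.comp_quasiMeasurePreserving Measure.quasiMeasurePreserving_snd))
    exact ((h1.comp_quasiMeasurePreserving Measure.quasiMeasurePreserving_snd).mul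
      ((hX.aemeasurable_prod_weightedAgg w κ measurable_fst).mul
        (Complex.continuous_conj.measurable.comp_aemeasurable
          (hX.aemeasurable_prod_weightedAgg w κ measurable_snd)))).aestronglyMeasurable
  · filter_upwards [Measure.quasiMeasurePreserving_fst.ae (hX.ae_dominator_ne_top hw)] with z hz
    rw [norm_mul, norm_mul, norm_mul, RCLike.norm_conj, RCLike.norm_conj, sq]
    have h1 := norm_prod_weightedAgg_le hw hz κ z.2.1
    have h2 := norm_prod_weightedAgg_le hw hz κ z.2.2
    have h3 : ‖g z.2.1‖ * ‖g z.2.2‖ ≤ 1 := mul_le_one₀ (hg1 _) (norm_nonneg _) (hg1 _)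
    exact (mul_le_of_le_one_left (by positivity) h3).trans
      (mul_le_mul h1 h2 (norm_nonneg _) ((norm_nonneg _).trans h1))

/-- The variance as a double integral over the character group: the second moment of the product
over the three towers factorises, and each factor is a covariance plus a product of means. -/
lemma IsSparseTower.complexVariance_weightedEst (hX : IsSparseTower P p X)
    (hw : AdmissibleWeights p w) (hg : AEMeasurable g ρ) (hg1 : ∀ γ, ‖g γ‖ ≤ 1) (κ : ℝ) :
    (complexVariance P (fun ω => weightedEst ρ g w κ fun j k => X j k ω) : ℂ) =
      ∫ z, g z.1 * (starRingEnd ℂ) (g z.2) *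
        (∏ j, (aggCov P w (X j) z.1 z.2 +
          aggMean P w κ (X j) z.1 * (starRingEnd ℂ) (aggMean P w κ (X j) z.2)) -
        ∏ j, aggMean P w κ (X j) z.1 * (starRingEnd ℂ) (aggMean P w κ (X j) z.2)) ∂(ρ.prod ρ) ∧
    Integrable (fun z : CharGroup G × CharGroup G => g z.1 * (starRingEnd ℂ) (g z.2) *
        (∏ j, (aggCov P w (X j) z.1 z.2 +
          aggMean P w κ (X j) z.1 * (starRingEnd ℂ) (aggMean P w κ (X j) z.2)) -
        ∏ j, aggMean P w κ (X j) z.1 * (starRingEnd ℂ) (aggMean P w κ (X j) z.2))) (ρ.prod ρ) := by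
  set Y : Ω → ℂ := fun ω => weightedEst ρ g w κ fun j k => X j k ω with hY
  have hL : MemLp Y 2 P := hX.memLp_weightedEst hw hg hg1 κ
  have hYi : Integrable Y P := hL.integrable one_le_two
  have hYc : Integrable (fun ω => (starRingEnd ℂ) (Y ω)) P :=
    (Complex.conjLIE.toContinuousLinearEquiv : ℂ →L[ℝ] ℂ).integrable_comp hYi
  have hYY : Integrable (fun ω => Y ω * (starRingEnd ℂ) (Y ω)) P :=
    hL.integrable_mul (hL.of_le hYc.1 (ae_of_all _ fun ω => (RCLike.norm_conj _).le))
  have hvar : (complexVariance P Y : ℂ) =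
      ∫ ω, Y ω * (starRingEnd ℂ) (Y ω) ∂P - mean P Y * (starRingEnd ℂ) (mean P Y) := by
    have e : ∀ ω, ((‖Y ω - mean P Y‖ ^ 2 : ℝ) : ℂ) = Y ω * (starRingEnd ℂ) (Y ω) -
        Y ω * (starRingEnd ℂ) (mean P Y) - mean P Y * (starRingEnd ℂ) (Y ω) +
          mean P Y * (starRingEnd ℂ) (mean P Y) := fun ω => by
      rw [Complex.ofReal_pow, ← Complex.mul_conj', map_sub]
      ring
    have i1 : Integrable (fun ω => Y ω * (starRingEnd ℂ) (mean P Y)) P := hYi.mul_const _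
    have i2 : Integrable (fun ω => mean P Y * (starRingEnd ℂ) (Y ω)) P := hYc.const_mul _
    have i3 : Integrable (fun ω => Y ω * (starRingEnd ℂ) (Y ω) -
      Y ω * (starRingEnd ℂ) (mean P Y)) P := hYY.sub i1
    have i4 : Integrable (fun ω => Y ω * (starRingEnd ℂ) (Y ω) -
      Y ω * (starRingEnd ℂ) (mean P Y) - mean P Y * (starRingEnd ℂ) (Y ω)) P := i3.sub i2
    rw [complexVariance, ← integral_complex_ofReal, integral_congr_ae (ae_of_all _ e),
      integral_add i4 (integrable_const _), integral_sub i3 i2, integral_sub hYY i1,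
      integral_mul_const, integral_const_mul, integral_conj, integral_const]
    have hmean : ∫ ω, Y ω ∂P = mean P Y := rfl
    simp only [hmean, probReal_univ, one_smul]
    ring
  have hI := hX.integrable_prod_mul_conj hw hg hg1 κ
  have hsecond : ∫ ω, Y ω * (starRingEnd ℂ) (Y ω) ∂P =
      ∫ z, g z.1 * (starRingEnd ℂ) (g z.2) *
        ∏ j, (aggCov P w (X j) z.1 z.2 +
          aggMean P w κ (X j) z.1 * (starRingEnd ℂ) (aggMean P w κ (X j) z.2)) ∂(ρ.prod ρ) := by
    have e : ∀ ω, Y ω * (starRingEnd ℂ) (Y ω) = ∫ z : CharGroup G × CharGroup G,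
        g z.1 * (starRingEnd ℂ) (g z.2) *
          ((∏ j, weightedAgg w κ (fun k => X j k ω) z.1) *
            (starRingEnd ℂ) (∏ j, weightedAgg w κ (fun k => X j k ω) z.2)) ∂(ρ.prod ρ) := fun ω => by
      simp only [hY, weightedEst]
      rw [← integral_conj, ← integral_prod_mul]
      refine integral_congr_ae (ae_of_all _ fun z => ?_)
      simp only [map_mul]
      ring
    rw [integral_congr_ae (ae_of_all _ e), integral_integral_swap hI]
    simp only [integral_const_mul, hX.integral_prod_weightedAgg_mul_conj hw]
  have hi1 : Integrable (fun z : CharGroup G × CharGroup G => g z.1 * (starRingEnd ℂ) (g z.2) *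
        ∏ j, (aggCov P w (X j) z.1 z.2 +
          aggMean P w κ (X j) z.1 * (starRingEnd ℂ) (aggMean P w κ (X j) z.2))) (ρ.prod ρ) := by
    have := hI.integral_prod_right
    simpa only [integral_const_mul, hX.integral_prod_weightedAgg_mul_conj hw] using this
  have hmi := hX.integrable_aggMean hw hg hg1 κ
  have hmc : Integrable (fun γ => (starRingEnd ℂ) (g γ * ∏ j, aggMean P w κ (X j) γ)) ρ :=
    (Complex.conjLIE.toContinuousLinearEquiv : ℂ →L[ℝ] ℂ).integrable_comp hmi
  have e2 : ∀ z : CharGroup G × CharGroup G,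
      (g z.1 * ∏ j, aggMean P w κ (X j) z.1) *
        (starRingEnd ℂ) (g z.2 * ∏ j, aggMean P w κ (X j) z.2) =
      g z.1 * (starRingEnd ℂ) (g z.2) *
        ∏ j, aggMean P w κ (X j) z.1 * (starRingEnd ℂ) (aggMean P w κ (X j) z.2) := fun z => by
    simp only [map_mul, map_prod, Finset.prod_mul_distrib]
    ring
  have hi2 : Integrable (fun z : CharGroup G × CharGroup G => g z.1 * (starRingEnd ℂ) (g z.2) *
        ∏ j, aggMean P w κ (X j) z.1 * (starRingEnd ℂ) (aggMean P w κ (X j) z.2)) (ρ.prod ρ) := by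
    have := hmi.mul_prod hmc
    simpa only [e2] using this
  simp only [mul_sub]
  refine ⟨?_, hi1.sub hi2⟩
  rw [hvar, hsecond, hX.mean_weightedEst hw hg hg1, integral_sub hi1 hi2, ← integral_conj,
    ← integral_prod_mul]
  simp only [e2]

end Estimators

/-! ### Perturbation of products of three factors -/

section Products

lemma norm_mul_three_sub_le {x y z x' y' z' : ℂ} {a b c da db dc : ℝ} (hy : ‖y‖ ≤ b)
    (hz : ‖z‖ ≤ c) (hx' : ‖x'‖ ≤ a) (hy' : ‖y'‖ ≤ b) (hdx : ‖x - x'‖ ≤ da)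
    (hdy : ‖y - y'‖ ≤ db) (hdz : ‖z - z'‖ ≤ dc) :
    ‖x * y * z - x' * y' * z'‖ ≤ da * b * c + a * db * c + a * b * dc := by
  have e : x * y * z - x' * y' * z' =
      (x - x') * y * z + x' * (y - y') * z + x' * y' * (z - z') := by ring
  have ha := (norm_nonneg _).trans hx'
  have hb := (norm_nonneg _).trans hy
  have hda := (norm_nonneg _).trans hdx
  have hdb := (norm_nonneg _).trans hdy
  rw [e]
  refine (norm_add₃_le).trans ?_
  simp only [norm_mul]
  gcongr

/-- Three factors of size `E`, each perturbed by at most `δ`. -/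
lemma norm_prod_sub_prod_le {e e' : Fin 3 → ℂ} {E δ : ℝ} (he : ∀ j, ‖e j‖ ≤ E)
    (he' : ∀ j, ‖e' j‖ ≤ E) (hd : ∀ j, ‖e j - e' j‖ ≤ δ) :
    ‖∏ j, e j - ∏ j, e' j‖ ≤ 3 * E ^ 2 * δ := by
  rw [Fin.prod_univ_three, Fin.prod_univ_three]
  refine (norm_mul_three_sub_le (he 1) (he 2) (he' 0) (he' 1) (hd 0) (hd 1) (hd 2)).trans_eq ?_
  ring

/-- In `∏(cⱼ + qⱼ) - ∏qⱼ` the dominant terms are `c q q`. If `c` is of order `M`, `q` is of order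
`M²`, and both are perturbed by a bounded amount, these terms change by order `M⁴`. -/
lemma norm_prod_add_sub_prod_sub_le {c c' q q' : Fin 3 → ℂ} {H M : ℝ} (hM : 1 ≤ M)
    (hc : ∀ j, ‖c j‖ ≤ H * M) (hc' : ∀ j, ‖c' j‖ ≤ H * M) (hdc : ∀ j, ‖c j - c' j‖ ≤ H)
    (hq : ∀ j, ‖q j‖ ≤ H * M ^ 2) (hq' : ∀ j, ‖q' j‖ ≤ H * M ^ 2)
    (hdq : ∀ j, ‖q j - q' j‖ ≤ H) :
    ‖(∏ j, (c j + q j) - ∏ j, q j) - (∏ j, (c' j + q' j) - ∏ j, q' j)‖ ≤ 21 * H ^ 3 * M ^ 4 := by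
  have hH : 0 ≤ H := (norm_nonneg _).trans (hdc 0)
  have h0 := norm_mul_three_sub_le (hc 1) (hc 2) (hc' 0) (hc' 1) (hdc 0) (hdc 1) (hdc 2)
  have h2 : ∀ i j k, ‖c i * c j * q k - c' i * c' j * q' k‖ ≤ _ := fun i j k =>
    norm_mul_three_sub_le (hc j) (hq k) (hc' i) (hc' j) (hdc i) (hdc j) (hdq k)
  have h1 : ∀ i j k, ‖c i * q j * q k - c' i * q' j * q' k‖ ≤ _ := fun i j k =>
    norm_mul_three_sub_le (hq j) (hq k) (hc' i) (hq' j) (hdc i) (hdq j) (hdq k)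
  have e : (∏ j, (c j + q j) - ∏ j, q j) - (∏ j, (c' j + q' j) - ∏ j, q' j) =
      (c 0 * c 1 * c 2 - c' 0 * c' 1 * c' 2) +
        ((c 0 * c 1 * q 2 - c' 0 * c' 1 * q' 2) + (c 0 * c 2 * q 1 - c' 0 * c' 2 * q' 1) +
          (c 1 * c 2 * q 0 - c' 1 * c' 2 * q' 0)) +
        ((c 0 * q 1 * q 2 - c' 0 * q' 1 * q' 2) + (c 1 * q 0 * q 2 - c' 1 * q' 0 * q' 2) +
          (c 2 * q 0 * q 1 - c' 2 * q' 0 * q' 1)) := by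
    simp only [Fin.prod_univ_three]
    ring
  have m2 : M ^ 2 ≤ M ^ 4 := pow_le_pow_right₀ hM (by norm_num)
  have m3 : M ^ 3 ≤ M ^ 4 := pow_le_pow_right₀ hM (by norm_num)
  have b2 : H ^ 3 * M ^ 2 ≤ H ^ 3 * M ^ 4 := by gcongr
  have b3 : H ^ 3 * M ^ 3 ≤ H ^ 3 * M ^ 4 := by gcongr
  rw [e]
  refine norm_add₃_le.trans ((add_le_add (add_le_add h0 (norm_add₃_le.trans
    (add_le_add (add_le_add (h2 0 1 2) (h2 0 2 1)) (h2 1 2 0)))) (norm_add₃_le.trans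
    (add_le_add (add_le_add (h1 0 1 2) (h1 1 0 2)) (h1 2 0 1)))).trans ?_)
  nlinarith [b2, b3]

end Products

/-! ### Size of the means and covariances, and the effect of truncation -/

section Weights

/-- The weight `e^{k/(3m)}` of cell `k`. -/
noncomputable def fullWeight (m : ℕ) (k : ℤ) : ℝ := Real.exp ((1 / 3 : ℝ) * (k : ℝ) / (m : ℝ))

/-- The weights of the cells `a ≤ k < b`. -/
noncomputable def truncWeight (m : ℕ) (a b : ℤ) (k : ℤ) : ℝ :=
  if a ≤ k ∧ k < b then fullWeight m k else 0

/-- The bound `min(1, λ e^{-k/m})`, with `x = log λ`, for the probability that cell `k` is nonzero. -/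
noncomputable def cellProb (m : ℕ) (x : ℝ) (k : ℤ) : ℝ := min 1 (Real.exp (x - k / m))

lemma fullWeight_pos (m : ℕ) (k : ℤ) : 0 < fullWeight m k := Real.exp_pos _

lemma truncWeight_nonneg (m : ℕ) (a b k : ℤ) : 0 ≤ truncWeight m a b k := by
  unfold truncWeight
  split_ifs
  exacts [(fullWeight_pos m k).le, le_rfl]

lemma truncWeight_le (m : ℕ) (a b k : ℤ) : truncWeight m a b k ≤ fullWeight m k := by
  unfold truncWeight
  split_ifs
  exacts [le_rfl, (fullWeight_pos m k).le]

lemma fullWeight_sq (m : ℕ) (k : ℤ) :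
    fullWeight m k ^ 2 = Real.exp ((2 / 3 : ℝ) * (k : ℝ) / (m : ℝ)) := by
  rw [fullWeight, ← Real.exp_nat_mul]
  push_cast
  ring_nf

lemma cellProb_nonneg (m : ℕ) (x : ℝ) (k : ℤ) : 0 ≤ cellProb m x k := by
  unfold cellProb; positivity

lemma cellProb_le_one (m : ℕ) (x : ℝ) (k : ℤ) : cellProb m x k ≤ 1 := min_le_left _ _

lemma sqrt_cellProb (m : ℕ) (x : ℝ) (k : ℤ) :
    √(cellProb m x k) = min 1 (Real.exp ((1 / 2 : ℝ) * (x - k / m))) := by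
  have h : √(Real.exp (x - k / m)) = Real.exp ((1 / 2 : ℝ) * (x - k / m)) := by
    rw [← Real.exp_half]; ring_nf
  rw [cellProb, Real.sqrt_monotone.map_min, Real.sqrt_one, h]

variable {m : ℕ} {x : ℝ} {a b : ℤ}

lemma admissibleWeights_fullWeight (hm : 1 ≤ m) (x : ℝ) :
    AdmissibleWeights (cellProb m x) (fullWeight m) where
  nonneg k := (fullWeight_pos m k).le
  summable_sqrt := by
    have h := (tsum_min_one_exp_le (x := x) (α := 1 / 3) (β := 1 / 2) hm (by norm_num)
      (by norm_num)).1
    refine h.congr fun k => ?_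
    rw [sqrt_cellProb, mul_comm]; rfl
  summable_sq := by
    have h := (tsum_min_one_exp_le (x := x) (α := 2 / 3) (β := 1) hm (by norm_num)
      (by norm_num)).1
    refine h.congr fun k => ?_
    rw [fullWeight_sq, cellProb, one_mul, mul_comm]

lemma AdmissibleWeights.mono {p w w' : ℤ → ℝ} (hw : AdmissibleWeights p w) (hp : ∀ k, 0 ≤ p k)
    (h0 : ∀ k, 0 ≤ w' k) (hle : ∀ k, w' k ≤ w k) : AdmissibleWeights p w' where
  nonneg := h0
  summable_sqrt := Summable.of_nonneg_of_le (fun k => mul_nonneg (h0 k) (Real.sqrt_nonneg _))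
    (fun k => by have := hle k; gcongr) hw.summable_sqrt
  summable_sq := Summable.of_nonneg_of_le (fun k => mul_nonneg (sq_nonneg _) (hp k))
    (fun k => by have := hle k; have := h0 k; have := hp k; gcongr) hw.summable_sq

lemma admissibleWeights_truncWeight (hm : 1 ≤ m) (x : ℝ) (a b : ℤ) :
    AdmissibleWeights (cellProb m x) (truncWeight m a b) :=
  (admissibleWeights_fullWeight hm x).mono (cellProb_nonneg m x) (truncWeight_nonneg m a b)
    (truncWeight_le m a b)

lemma tsum_cellProb_mul_fullWeight_le (hm : 1 ≤ m) (x : ℝ) :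
    Summable (fun k => cellProb m x k * fullWeight m k) ∧
      ∑' k, cellProb m x k * fullWeight m k ≤ 7 * m * Real.exp (x / 3) := by
  have h := tsum_min_one_exp_le (x := x) (α := 1 / 3) (β := 1) hm (by norm_num) (by norm_num)
  simp only [one_mul] at h
  refine ⟨h.1, h.2.trans ?_⟩
  have hm' : (1 : ℝ) ≤ m := by exact_mod_cast hm
  rw [show (1 / 3 : ℝ) * x = x / 3 by ring, ← add_mul]
  gcongr
  ring_nf
  linarith

lemma tsum_cellProb_mul_fullWeight_sq_le (hm : 1 ≤ m) (x : ℝ) :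
    Summable (fun k => cellProb m x k * fullWeight m k ^ 2) ∧
      ∑' k, cellProb m x k * fullWeight m k ^ 2 ≤ 7 * m * Real.exp (x / 3) ^ 2 := by
  have h := tsum_min_one_exp_le (x := x) (α := 2 / 3) (β := 1) hm (by norm_num) (by norm_num)
  simp only [one_mul, ← fullWeight_sq] at h
  refine ⟨h.1, h.2.trans ?_⟩
  have hm' : (1 : ℝ) ≤ m := by exact_mod_cast hm
  have e : Real.exp (2 / 3 * x) = Real.exp (x / 3) ^ 2 := by
    rw [← Real.exp_nat_mul]; push_cast; ring_nf
  rw [e, ← add_mul]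
  gcongr
  ring_nf
  linarith

/-- The tails of the mean: below the threshold `a ≤ m (log λ - 6 log m)` and above the threshold
`b ≥ m (log λ + 3 log m)` the weighted sums are of order `λ^{1/3} / m`. -/
lemma tsum_cellProb_mul_fullWeight_tail_le (hm : 1 ≤ m) (ha : (a : ℝ) ≤ m * (x - 6 * Real.log m))
    (hb : m * (x + 3 * Real.log m) ≤ (b : ℝ)) :
    Summable (fun k => if k < a ∨ b ≤ k then cellProb m x k * fullWeight m k else 0) ∧
      ∑' k, (if k < a ∨ b ≤ k then cellProb m x k * fullWeight m k else 0) ≤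
        7 * (Real.exp (x / 3) / m) := by
  have h := tsum_min_one_exp_tail_le (x := x) (y := x - 6 * Real.log m) (a := a)
    (α := 1 / 3) (β := 1) hm (by norm_num) (by norm_num)
    (by linarith) hb
  simp only [one_mul] at h
  refine ⟨h.1, h.2.trans ?_⟩
  have hm' : (1 : ℝ) ≤ m := by exact_mod_cast hm
  have hlog : Real.exp (Real.log m) = m := Real.exp_log (by linarith)
  have e1 : Real.exp (1 / 3 * (x - 6 * Real.log m)) = Real.exp (x / 3) / m ^ 2 := by
    rw [show 1 / 3 * (x - 6 * Real.log m) = x / 3 - (2 : ℕ) * Real.log m by push_cast; ring,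
      Real.exp_sub, Real.exp_nat_mul, hlog]
  have e2 : Real.exp (x - (1 - 1 / 3) * (x + 3 * Real.log m)) = Real.exp (x / 3) / m ^ 2 := by
    rw [show x - (1 - 1 / 3) * (x + 3 * Real.log m) = x / 3 - (2 : ℕ) * Real.log m by
      push_cast; ring, Real.exp_sub, Real.exp_nat_mul, hlog]
  rw [e1, e2, ← add_mul]
  calc _ ≤ 7 * (m : ℝ) * (Real.exp (x / 3) / m ^ 2) := by gcongr; ring_nf; linarith
    _ = _ := by field_simp

/-- The tails of the covariance are of order `λ^{2/3}`. -/
lemma tsum_cellProb_mul_fullWeight_sq_tail_le (hm : 1 ≤ m)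
    (ha : (a : ℝ) ≤ m * (x - 6 * Real.log m)) (hb : m * (x + 3 * Real.log m) ≤ (b : ℝ)) :
    Summable (fun k => if k < a ∨ b ≤ k then cellProb m x k * fullWeight m k ^ 2 else 0) ∧
      ∑' k, (if k < a ∨ b ≤ k then cellProb m x k * fullWeight m k ^ 2 else 0) ≤
        7 * Real.exp (x / 3) ^ 2 := by
  have h := tsum_min_one_exp_tail_le (x := x) (y := x - 6 * Real.log m) (a := a)
    (α := 2 / 3) (β := 1) hm (by norm_num) (by norm_num)
    (by linarith) hb
  simp only [one_mul, ← fullWeight_sq] at h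
  refine ⟨h.1, h.2.trans ?_⟩
  have hm' : (1 : ℝ) ≤ m := by exact_mod_cast hm
  have hlog : Real.exp (Real.log m) = m := Real.exp_log (by linarith)
  have e0 : Real.exp (x / 3) ^ 2 = Real.exp (2 / 3 * x) := by
    rw [← Real.exp_nat_mul]; push_cast; ring_nf
  have e1 : Real.exp (2 / 3 * (x - 6 * Real.log m)) ≤ Real.exp (x / 3) ^ 2 / m := by
    rw [show 2 / 3 * (x - 6 * Real.log m) = 2 / 3 * x - (4 : ℕ) * Real.log m by push_cast; ring,
      Real.exp_sub, Real.exp_nat_mul, hlog, e0]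
    gcongr
    exact le_self_pow₀ hm' (by norm_num)
  have e2 : Real.exp (x - (1 - 2 / 3) * (x + 3 * Real.log m)) = Real.exp (x / 3) ^ 2 / m := by
    rw [show x - (1 - 2 / 3) * (x + 3 * Real.log m) = 2 / 3 * x - Real.log m by ring,
      Real.exp_sub, hlog, e0]
  rw [e2]
  calc _ ≤ (1 + m / (2 / 3)) * (Real.exp (x / 3) ^ 2 / m) +
        (1 + m / (1 - 2 / 3)) * (Real.exp (x / 3) ^ 2 / m) := by gcongr
    _ = (1 + m / (2 / 3) + (1 + m / (1 - 2 / 3))) * (Real.exp (x / 3) ^ 2 / m) := by ring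
    _ ≤ 7 * (m : ℝ) * (Real.exp (x / 3) ^ 2 / m) := by gcongr; ring_nf; linarith
    _ = _ := by field_simp

lemma correction_nonneg (hm : 1 ≤ m) (a : ℤ) : 0 ≤ correction m a := by
  have hm' : (0 : ℝ) < m := by exact_mod_cast hm
  have : Real.exp (-1 / (3 * (m : ℝ))) ≤ 1 :=
    Real.exp_le_one_iff.2 (div_nonpos_of_nonpos_of_nonneg (by norm_num) (by positivity))
  unfold correction
  have h := sub_nonneg.2 this
  positivity

lemma correction_le (hm : 1 ≤ m) (ha : (a : ℝ) ≤ m * (x - 6 * Real.log m)) :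
    correction m a ≤ 4 * (Real.exp (x / 3) / m) := by
  have hm' : (1 : ℝ) ≤ m := by exact_mod_cast hm
  have hlog : Real.exp (Real.log m) = m := Real.exp_log (by linarith)
  have h1 : Real.exp ((1 / 3 : ℝ) * ((a : ℝ) - 1) / m) ≤ Real.exp (x / 3) / m ^ 2 := by
    have e1 : Real.exp (1 / 3 * (x - 6 * Real.log m)) = Real.exp (x / 3) / m ^ 2 := by
      rw [show 1 / 3 * (x - 6 * Real.log m) = x / 3 - (2 : ℕ) * Real.log m by push_cast; ring,
        Real.exp_sub, Real.exp_nat_mul, hlog]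
    rw [← e1, Real.exp_le_exp, div_le_iff₀ (by linarith)]
    linarith
  have h2 : 1 / (1 - Real.exp (-1 / (3 * (m : ℝ)))) ≤ 4 * m := by
    have h := inv_one_sub_exp_neg_le (r := 1 / (3 * (m : ℝ))) (by positivity)
    rw [one_div, neg_div]
    refine h.trans ?_
    rw [one_div_one_div]
    linarith
  have h3 : 0 ≤ 1 / (1 - Real.exp (-1 / (3 * (m : ℝ)))) := by
    have : Real.exp (-1 / (3 * (m : ℝ))) ≤ 1 :=
      Real.exp_le_one_iff.2 (div_nonpos_of_nonpos_of_nonneg (by norm_num) (by positivity))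
    have := sub_nonneg.2 this
    positivity
  calc correction m a ≤ Real.exp (x / 3) / m ^ 2 * (4 * m) := by
        unfold correction; gcongr
    _ = _ := by field_simp

lemma norm_tsum_mul_le {d : ℤ → ℂ} {p v : ℤ → ℝ} {c : ℝ} (hd : ∀ k, ‖d k‖ ≤ c * p k)
    (hv : ∀ k, 0 ≤ v k) (hs : Summable fun k => p k * v k) :
    Summable (fun k => d k * (v k : ℂ)) ∧ ‖∑' k, d k * (v k : ℂ)‖ ≤ c * ∑' k, p k * v k := by
  have hb : ∀ k, ‖d k * (v k : ℂ)‖ ≤ c * (p k * v k) := fun k => by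
    rw [norm_mul, Complex.norm_real, Real.norm_of_nonneg (hv k), ← mul_assoc]
    have := hv k
    gcongr
    exact hd k
  refine ⟨Summable.of_norm_bounded (hs.mul_left c) hb, ?_⟩
  rw [← tsum_mul_left]
  exact tsum_of_norm_bounded (hs.mul_left c).hasSum hb

variable {G : Type u} [AddCommGroup G] [TopologicalSpace G] [MeasurableSpace G] [BorelSpace G]
  [T2Space G] {Ω : Type v} [MeasurableSpace Ω] {P : Measure Ω} [IsProbabilityMeasure P]
  {X : Fin 3 → ℤ → Ω → G}

/-- The means of the full and of the truncated aggregation are of order `m λ^{1/3}`; they differ by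
the tails of the series and the correction term, both of order `λ^{1/3} / m`. -/
lemma aggMean_bounds (hm : 1 ≤ m) (hX : IsSparseTower P (cellProb m x) X)
    (ha : (a : ℝ) ≤ m * (x - 6 * Real.log m)) (hb : m * (x + 3 * Real.log m) ≤ (b : ℝ))
    (j : Fin 3) (γ : CharGroup G) :
    ‖aggMean P (fullWeight m) 0 (X j) γ‖ ≤ 18 * (m * Real.exp (x / 3)) ∧
    ‖aggMean P (truncWeight m a b) (correction m a) (X j) γ‖ ≤ 18 * (m * Real.exp (x / 3)) ∧
    ‖aggMean P (truncWeight m a b) (correction m a) (X j) γ - aggMean P (fullWeight m) 0 (X j) γ‖ ≤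
      18 * (Real.exp (x / 3) / m) := by
  have hm' : (1 : ℝ) ≤ m := by exact_mod_cast hm
  have hL := Real.exp_pos (x / 3)
  have hd : ∀ k, ‖cellMean P (X j k) γ‖ ≤ 2 * cellProb m x k := fun k =>
    norm_cellMean_le (hX.aemeasurable j k) (hX.nonneg k) (hX.measure_ne_zero_le j k) γ
  obtain ⟨s1, b1⟩ := tsum_cellProb_mul_fullWeight_le hm x
  obtain ⟨s2, b2⟩ := tsum_cellProb_mul_fullWeight_tail_le hm ha hb
  obtain ⟨t1, f1⟩ := norm_tsum_mul_le hd (fun k => (fullWeight_pos m k).le) s1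
  have hκ0 := correction_nonneg hm a
  have hκ := correction_le hm ha
  have hs3 : Summable fun k => cellProb m x k * truncWeight m a b k :=
    Summable.of_nonneg_of_le (fun k => mul_nonneg (cellProb_nonneg m x k) (truncWeight_nonneg ..))
      (fun k => mul_le_mul_of_nonneg_left (truncWeight_le ..) (cellProb_nonneg m x k)) s1
  obtain ⟨t3, f3⟩ := norm_tsum_mul_le hd (truncWeight_nonneg m a b) hs3
  have hsub : ∀ k, cellProb m x k * (fullWeight m k - truncWeight m a b k) =
      if k < a ∨ b ≤ k then cellProb m x k * fullWeight m k else 0 := fun k => by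
    unfold truncWeight
    by_cases h : a ≤ k ∧ k < b
    · have : ¬ (k < a ∨ b ≤ k) := by omega
      simp [h, this]
    · have : k < a ∨ b ≤ k := by omega
      simp [h, this]
  obtain ⟨t4, f4⟩ := norm_tsum_mul_le (v := fun k => fullWeight m k - truncWeight m a b k) hd
    (fun k => sub_nonneg.2 (truncWeight_le m a b k)) (by simpa only [hsub] using s2)
  simp only [hsub] at f4
  have e1 : aggMean P (truncWeight m a b) (correction m a) (X j) γ -
      aggMean P (fullWeight m) 0 (X j) γ =
      -(∑' k, cellMean P (X j k) γ * ((fullWeight m k - truncWeight m a b k : ℝ) : ℂ)) -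
        (correction m a : ℂ) := by
    simp only [aggMean, Complex.ofReal_sub, mul_sub]
    rw [t1.tsum_sub t3]
    push_cast
    ring
  have hLm : Real.exp (x / 3) / m ≤ m * Real.exp (x / 3) := by
    exact (div_le_self hL.le hm').trans (le_mul_of_one_le_left hL.le hm')
  refine ⟨?_, ?_, ?_⟩
  · simp only [aggMean, Complex.ofReal_zero, sub_zero]
    nlinarith
  · refine (norm_sub_le _ _).trans ?_
    rw [Complex.norm_real, Real.norm_of_nonneg hκ0]
    have h5 : ∑' k, cellProb m x k * truncWeight m a b k ≤
        ∑' k, cellProb m x k * fullWeight m k := hs3.tsum_le_tsum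
      (fun k => mul_le_mul_of_nonneg_left (truncWeight_le ..) (cellProb_nonneg m x k)) s1
    nlinarith
  · rw [e1]
    refine (norm_sub_le _ _).trans ?_
    rw [norm_neg, Complex.norm_real, Real.norm_of_nonneg hκ0]
    linarith

/-- The covariances of both aggregations are of order `m λ^{2/3}` and differ by tails of order
`λ^{2/3}`. The correction term, being deterministic, does not contribute. -/
lemma aggCov_bounds (hm : 1 ≤ m) (hX : IsSparseTower P (cellProb m x) X)
    (ha : (a : ℝ) ≤ m * (x - 6 * Real.log m)) (hb : m * (x + 3 * Real.log m) ≤ (b : ℝ))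
    (j : Fin 3) (γ γ' : CharGroup G) :
    ‖aggCov P (fullWeight m) (X j) γ γ'‖ ≤ 56 * (m * Real.exp (x / 3) ^ 2) ∧
    ‖aggCov P (truncWeight m a b) (X j) γ γ'‖ ≤ 56 * (m * Real.exp (x / 3) ^ 2) ∧
    ‖aggCov P (truncWeight m a b) (X j) γ γ' - aggCov P (fullWeight m) (X j) γ γ'‖ ≤
      56 * Real.exp (x / 3) ^ 2 := by
  have hd : ∀ k, ‖cellCov P (X j k) γ γ'‖ ≤ 8 * cellProb m x k := fun k =>
    norm_cellCov_le (hX.aemeasurable j k) (hX.nonneg k) (hX.le_one k)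
      (hX.measure_ne_zero_le j k) γ γ'
  have hle : ∀ k, truncWeight m a b k ^ 2 ≤ fullWeight m k ^ 2 := fun k =>
    pow_le_pow_left₀ (truncWeight_nonneg ..) (truncWeight_le ..) 2
  obtain ⟨s1, b1⟩ := tsum_cellProb_mul_fullWeight_sq_le hm x
  obtain ⟨s2, b2⟩ := tsum_cellProb_mul_fullWeight_sq_tail_le hm ha hb
  have hs3 : Summable fun k => cellProb m x k * truncWeight m a b k ^ 2 :=
    Summable.of_nonneg_of_le (fun k => mul_nonneg (cellProb_nonneg m x k) (sq_nonneg _))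
      (fun k => mul_le_mul_of_nonneg_left (hle k) (cellProb_nonneg m x k)) s1
  have hsub : ∀ k, cellProb m x k * (fullWeight m k ^ 2 - truncWeight m a b k ^ 2) =
      if k < a ∨ b ≤ k then cellProb m x k * fullWeight m k ^ 2 else 0 := fun k => by
    unfold truncWeight
    by_cases h : a ≤ k ∧ k < b
    · have : ¬ (k < a ∨ b ≤ k) := by omega
      simp [h, this]
    · have : k < a ∨ b ≤ k := by omega
      simp [h, this]
  obtain ⟨t1, f1⟩ := norm_tsum_mul_le hd (fun k => sq_nonneg (fullWeight m k)) s1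
  obtain ⟨t3, f3⟩ := norm_tsum_mul_le hd (fun k => sq_nonneg (truncWeight m a b k)) hs3
  obtain ⟨t4, f4⟩ := norm_tsum_mul_le
    (v := fun k => fullWeight m k ^ 2 - truncWeight m a b k ^ 2) hd
    (fun k => sub_nonneg.2 (hle k)) (by simpa only [hsub] using s2)
  simp only [hsub] at f4
  simp only [Complex.ofReal_pow] at t1 t3 f1 f3
  have e1 : aggCov P (truncWeight m a b) (X j) γ γ' - aggCov P (fullWeight m) (X j) γ γ' =
      -(∑' k, cellCov P (X j k) γ γ' *
        ((fullWeight m k ^ 2 - truncWeight m a b k ^ 2 : ℝ) : ℂ)) := by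
    simp only [aggCov, Complex.ofReal_sub, Complex.ofReal_pow, mul_sub]
    rw [t1.tsum_sub t3]
    ring
  have h5 : ∑' k, cellProb m x k * truncWeight m a b k ^ 2 ≤
      ∑' k, cellProb m x k * fullWeight m k ^ 2 := hs3.tsum_le_tsum
    (fun k => mul_le_mul_of_nonneg_left (hle k) (cellProb_nonneg m x k)) s1
  refine ⟨f1.trans ?_, f3.trans ?_, ?_⟩
  · linarith
  · linarith
  · rw [e1, norm_neg]
    linarith

variable [MeasurableSpace (CharGroup G)] [BorelSpace (CharGroup G)] {ρ : Measure (CharGroup G)}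
  [IsFiniteMeasure ρ] {g : CharGroup G → ℂ}

lemma norm_mean_sub_le (hm : 1 ≤ m) (hX : IsSparseTower P (cellProb m x) X)
    (ha : (a : ℝ) ≤ m * (x - 6 * Real.log m)) (hb : m * (x + 3 * Real.log m) ≤ (b : ℝ))
    (hg : AEMeasurable g ρ) (hg1 : ∀ γ, ‖g γ‖ ≤ 1) :
    ‖mean P (fun ω => weightedEst ρ g (truncWeight m a b) (correction m a) fun j k => X j k ω) -
      mean P (fun ω => weightedEst ρ g (fullWeight m) 0 fun j k => X j k ω)‖ ≤
      3 * 18 ^ 3 * (m * Real.exp x) * ρ.real Set.univ := by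
  have hw := admissibleWeights_fullWeight hm x
  have hw' := admissibleWeights_truncWeight hm x a b
  have hm' : (1 : ℝ) ≤ m := by exact_mod_cast hm
  rw [hX.mean_weightedEst hw hg hg1, hX.mean_weightedEst hw' hg hg1,
    ← integral_sub (hX.integrable_aggMean hw' hg hg1 _) (hX.integrable_aggMean hw hg hg1 _)]
  refine norm_integral_le_of_norm_le_const (ae_of_all _ fun γ => ?_)
  rw [← mul_sub, norm_mul]
  refine (mul_le_of_le_one_left (norm_nonneg _) (hg1 γ)).trans ?_
  refine (norm_prod_sub_prod_le (fun j => (aggMean_bounds hm hX ha hb j γ).2.1)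
    (fun j => (aggMean_bounds hm hX ha hb j γ).1)
    (fun j => (aggMean_bounds hm hX ha hb j γ).2.2)).trans_eq ?_
  have e : Real.exp x = Real.exp (x / 3) ^ 3 := by
    rw [← Real.exp_nat_mul]; push_cast; ring_nf
  rw [e]
  field_simp

lemma abs_complexVariance_sub_le (hm : 1 ≤ m) (hX : IsSparseTower P (cellProb m x) X)
    (ha : (a : ℝ) ≤ m * (x - 6 * Real.log m)) (hb : m * (x + 3 * Real.log m) ≤ (b : ℝ))
    (hg : AEMeasurable g ρ) (hg1 : ∀ γ, ‖g γ‖ ≤ 1) :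
    |complexVariance P
        (fun ω => weightedEst ρ g (truncWeight m a b) (correction m a) fun j k => X j k ω) -
      complexVariance P (fun ω => weightedEst ρ g (fullWeight m) 0 fun j k => X j k ω)| ≤
      21 * 648 ^ 3 * (m ^ 4 * Real.exp x ^ 2) * ρ.real Set.univ ^ 2 := by
  have hw := admissibleWeights_fullWeight hm x
  have hw' := admissibleWeights_truncWeight hm x a b
  have hm' : (1 : ℝ) ≤ m := by exact_mod_cast hm
  obtain ⟨v1, i1⟩ := hX.complexVariance_weightedEst hw hg hg1 0
  obtain ⟨v2, i2⟩ := hX.complexVariance_weightedEst hw' hg hg1 (correction m a)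
  rw [← Real.norm_eq_abs, ← Complex.norm_real, Complex.ofReal_sub, v1, v2, ← integral_sub i2 i1]
  have hρ : ρ.real Set.univ ^ 2 = (ρ.prod ρ).real Set.univ := by
    rw [← Set.univ_prod_univ, measureReal_prod_prod, sq]
  rw [hρ]
  refine norm_integral_le_of_norm_le_const (ae_of_all _ fun z => ?_)
  rw [← mul_sub, norm_mul, norm_mul, RCLike.norm_conj]
  refine (mul_le_of_le_one_left (norm_nonneg _)
    (mul_le_one₀ (hg1 _) (norm_nonneg _) (hg1 _))).trans ?_
  set L := Real.exp (x / 3) with hLdef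
  have hL : 0 < L := Real.exp_pos _
  -- `648 = 2 * 18 ^ 2` bounds the change of a product of two means
  have hqb : ∀ e e' : ℂ, ‖e‖ ≤ 18 * (m * L) → ‖e'‖ ≤ 18 * (m * L) →
      ‖e * (starRingEnd ℂ) e'‖ ≤ 648 * L ^ 2 * (m : ℝ) ^ 2 := fun e e' h h' => by
    rw [norm_mul, RCLike.norm_conj]
    calc _ ≤ 18 * (m * L) * (18 * (m * L)) := by gcongr
      _ ≤ _ := by nlinarith [sq_nonneg (L * m)]
  have hcm : (56 : ℝ) * (m * L ^ 2) ≤ 648 * L ^ 2 * m := by nlinarith [mul_pos hL hL]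
  refine (norm_prod_add_sub_prod_sub_le (H := 648 * L ^ 2) hm'
    (fun j => (aggCov_bounds hm hX ha hb j z.1 z.2).2.1.trans hcm)
    (fun j => (aggCov_bounds hm hX ha hb j z.1 z.2).1.trans hcm)
    (fun j => (aggCov_bounds hm hX ha hb j z.1 z.2).2.2.trans (by gcongr; norm_num))
    (fun j => hqb _ _ (aggMean_bounds hm hX ha hb j z.1).2.1
      (aggMean_bounds hm hX ha hb j z.2).2.1)
    (fun j => hqb _ _ (aggMean_bounds hm hX ha hb j z.1).1 (aggMean_bounds hm hX ha hb j z.2).1)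
    (fun j => ?_)).trans_eq ?_
  · obtain ⟨-, p2, p3⟩ := aggMean_bounds hm hX ha hb j z.1
    obtain ⟨q1, -, q3⟩ := aggMean_bounds hm hX ha hb j z.2
    generalize aggMean P (truncWeight m a b) (correction m a) (X j) z.1 = e1 at *
    generalize aggMean P (truncWeight m a b) (correction m a) (X j) z.2 = e2 at *
    generalize aggMean P (fullWeight m) 0 (X j) z.1 = f1 at *
    generalize aggMean P (fullWeight m) 0 (X j) z.2 = f2 at *
    have e : e1 * (starRingEnd ℂ) e2 - f1 * (starRingEnd ℂ) f2 =
        e1 * (starRingEnd ℂ) (e2 - f2) + (e1 - f1) * (starRingEnd ℂ) f2 := by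
      rw [map_sub]; ring
    rw [e]
    refine (norm_add_le _ _).trans ?_
    rw [norm_mul, norm_mul, RCLike.norm_conj, RCLike.norm_conj]
    calc _ ≤ 18 * (m * L) * (18 * (L / m)) + 18 * (L / m) * (18 * (m * L)) := by gcongr
      _ = 648 * L ^ 2 := by field_simp; norm_num
  · have e : Real.exp x = L ^ 3 := by
      rw [hLdef, ← Real.exp_nat_mul]; push_cast; ring_nf
    rw [e]
    ring

end Weights

/-! ### Poisson towers are sparse -/

section Sparse

lemma poissonMeasure_ne_zero_le {s : ℝ} (hs : 0 ≤ s) :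
    poissonMeasure s.toNNReal {n | n ≠ 0} ≤ ENNReal.ofReal s := by
  have h : {n : ℕ | n ≠ 0} = {0}ᶜ := rfl
  rw [h, prob_compl_eq_one_sub (measurableSet_singleton 0), poissonMeasure_singleton]
  simp only [Real.coe_toNNReal s hs, pow_zero, mul_one, Nat.factorial_zero, Nat.cast_one, div_one]
  rw [← ENNReal.ofReal_one, ← ENNReal.ofReal_sub _ (Real.exp_nonneg _)]
  exact ENNReal.ofReal_le_ofReal (by linarith [Real.add_one_le_exp (-s)])

lemma exp_log_sub_div {lam : ℝ} (hlam : 0 < lam) (m : ℕ) (k : ℤ) :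
    Real.exp (Real.log lam - k / m) = lam * Real.exp (-(k : ℝ) / m) := by
  rw [sub_eq_add_neg, Real.exp_add, Real.exp_log hlam, neg_div]

lemma measure_le_ofReal_cellProb {Ω : Type v} [MeasurableSpace Ω] {P : Measure Ω}
    [IsProbabilityMeasure P] {s : Set Ω} {lam : ℝ} (hlam : 0 < lam) {m : ℕ} {k : ℤ}
    (h : P s ≤ ENNReal.ofReal (lam * Real.exp (-(k : ℝ) / m))) :
    P s ≤ ENNReal.ofReal (cellProb m (Real.log lam) k) := by
  rw [cellProb, exp_log_sub_div hlam]
  rcases min_choice 1 (lam * Real.exp (-(k : ℝ) / m)) with e | e <;> rw [e]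
  · simpa using prob_le_one
  · exact h

variable {G : Type u} [AddCommGroup G] [MeasurableSpace G]

/-- A compound Poisson variable vanishes unless the number of summands is positive. -/
lemma compoundPoisson_ne_zero_le {s : ℝ} (hs : 0 ≤ s) (μR : Measure G) [IsProbabilityMeasure μR]
    (h0 : MeasurableSet {y : G | y ≠ 0}) :
    compoundPoisson s μR {y : G | y ≠ 0} ≤ ENNReal.ofReal s := by
  -- if the random sum is not measurable, the measure is `0` by convention
  by_cases hm : AEMeasurable (fun p : ℕ × (ℕ → G) => ∑ r ∈ Finset.range p.1, p.2 r)
      ((poissonMeasure s.toNNReal).prod (Measure.infinitePi fun _ : ℕ => μR))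
  · rw [compoundPoisson, Measure.map_apply_of_aemeasurable hm h0]
    calc _ ≤ ((poissonMeasure s.toNNReal).prod (Measure.infinitePi fun _ : ℕ => μR))
          ({n | n ≠ 0} ×ˢ Set.univ) := by
          refine measure_mono fun p hp => ⟨fun hp0 => hp ?_, Set.mem_univ _⟩
          simp [show p.1 = 0 from hp0]
      _ ≤ ENNReal.ofReal s := by
          rw [Measure.prod_prod, measure_univ, mul_one]
          exact poissonMeasure_ne_zero_le hs
  · rw [compoundPoisson, Measure.map_of_not_aemeasurable hm]
    simp

variable [TopologicalSpace G] {Ω : Type v} [MeasurableSpace Ω]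
  {P : Measure Ω} [IsProbabilityMeasure P] {m : ℕ} {X : Fin 3 → ℤ → Ω → G}

lemma IsTriplePoissonTower.isSparseTower [BorelSpace G] [T2Space G] {lam : ℝ} (hlam : 0 < lam)
    {μR : Measure G} (h : IsTriplePoissonTower P m lam μR X) :
    IsSparseTower P (cellProb m (Real.log lam)) X where
  nonneg := cellProb_nonneg _ _
  le_one := cellProb_le_one _ _
  aestronglyMeasurable := h.aestronglyMeasurable
  aemeasurable j k := (h.law j k).aemeasurable
  indep := h.indep
  measure_ne_zero_le j k := by
    have := h.isProbabilityMeasure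
    refine measure_le_ofReal_cellProb hlam ?_
    rw [(h.law j k).measure_eq (p := fun y => y ≠ 0) measurableSet_ne_zero]
    exact compoundPoisson_ne_zero_le (by positivity) μR measurableSet_ne_zero

lemma IsTripleSketch.isSparseTower [ContinuousAdd G] {n : ℕ} {x : Fin n → G}
    (hpos : 0 < (supportSize x : ℝ)) (h : IsTripleSketch P m x X) :
    IsSparseTower P (cellProb m (Real.log (supportSize x))) X := by
  obtain ⟨Z, hlaw, hind, hXZ⟩ := h
  have hZ : ∀ j k v, AEMeasurable (Z j k v) P := fun j k v => (hlaw j k v).aemeasurable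
  -- measurable although addition of `G` need not be, because `Fin n → ℕ` is countable
  have hF : Measurable fun z : Fin n → ℕ => ∑ v, z v • x v := measurable_of_countable _
  have hX : ∀ j k, X j k = fun ω => ∑ v, Z j k v ω • x v := fun j k => funext (hXZ j k)
  refine ⟨cellProb_nonneg _ _, cellProb_le_one _ _, fun j k => ?_, fun j k => ?_, ?_,
    fun j k => measure_le_ofReal_cellProb hpos ?_⟩
  · rw [hX]
    refine Finset.aestronglyMeasurable_fun_sum _ fun v _ => ?_
    exact (continuous_of_discreteTopology (f := fun z : ℕ => z • x v)).comp_aestronglyMeasurable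
      (hZ j k v).aestronglyMeasurable
  · rw [hX]
    exact hF.comp_aemeasurable (aemeasurable_pi_iff.2 (hZ j k))
  · -- the blocks `(Z j k v)_v` are independent, and cell `(j, k)` is a function of its block
    have h1 := hind.precomp (g := Equiv.prodAssoc (Fin 3) ℤ (Fin n)) (Equiv.injective _)
    have h2 := iIndepFun_curry (X := fun (i : Fin 3 × ℤ) v => Z i.1 i.2 v)
      (fun i v => hZ i.1 i.2 v) h1
    have h3 := h2.comp (fun _ z => ∑ v, z v • x v) fun _ => hF
    simp only [hX]
    exact h3
  · -- the cell vanishes unless some coordinate in the support has a positive multiplicity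
    classical
    have hsub : {ω | X j k ω ≠ 0} ⊆
        ⋃ v ∈ Finset.univ.filter (fun v => x v ≠ 0), {ω | Z j k v ω ≠ 0} := by
      intro ω hω
      rw [Set.mem_ofPred_eq, hXZ] at hω
      obtain ⟨v, -, hv⟩ := Finset.exists_ne_zero_of_sum_ne_zero hω
      simp only [Set.mem_iUnion, Finset.mem_filter, Finset.mem_univ, true_and]
      exact ⟨v, fun h0 => hv (by simp [h0]), fun h0 => hv (by
        rw [show Z j k v ω = 0 from h0, zero_smul])⟩
    have hcard : supportSize x = (Finset.univ.filter (fun v => x v ≠ 0)).card := by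
      rw [supportSize, ← Set.ncard_coe_finset]
      simp
    calc P {ω | X j k ω ≠ 0}
        ≤ ∑ v ∈ Finset.univ.filter (fun v => x v ≠ 0), P {ω | Z j k v ω ≠ 0} :=
          (measure_mono hsub).trans (measure_biUnion_finset_le _ _)
      _ ≤ ∑ v ∈ Finset.univ.filter (fun v => x v ≠ 0),
          ENNReal.ofReal (Real.exp (-(k : ℝ) / m)) := by
          refine Finset.sum_le_sum fun v _ => ?_
          rw [(hlaw j k v).measure_eq (p := fun z => z ≠ 0) (MeasurableSet.of_discrete)]
          exact poissonMeasure_ne_zero_le (Real.exp_nonneg _)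
      _ = ENNReal.ofReal (supportSize x * Real.exp (-(k : ℝ) / m)) := by
          rw [Finset.sum_const, nsmul_eq_mul, hcard, ENNReal.ofReal_mul (by positivity),
            ENNReal.ofReal_natCast]

end Sparse

/-! ### Reduction of the estimators to weighted aggregations -/

section Reduction

section Agg

variable {G : Type u} [AddCommGroup G] [TopologicalSpace G]

lemma agg_eq_weightedAgg (m : ℕ) (x : ℤ → G) (γ : CharGroup G) :
    agg m x γ = weightedAgg (fullWeight m) 0 x γ := by
  simp [agg, weightedAgg, aggTerm, fullWeight]

lemma aggTrunc_sub_correction_eq_weightedAgg (m : ℕ) (a b : ℤ) (x : ℤ → G) (γ : CharGroup G) :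
    aggTrunc m a b x γ - (correction m a : ℂ) =
      weightedAgg (truncWeight m a b) (correction m a) x γ := by
  rw [weightedAgg, aggTrunc, tsum_eq_sum (s := Finset.Ico a b)]
  · congr 1
    refine Finset.sum_congr rfl fun k hk => ?_
    simp [aggTerm, truncWeight, fullWeight, Finset.mem_Ico.1 hk]
  · intro k hk
    have : ¬ (a ≤ k ∧ k < b) := fun h => hk (Finset.mem_Ico.2 h)
    simp [truncWeight, this]

end Agg

variable {T : Type*}

/-- The phase `F / |F|` of a complex function, equal to `0` where `F` vanishes. -/
noncomputable def phase (F : T → ℂ) (t : T) : ℂ := F t / (‖F t‖ : ℂ)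

lemma norm_phase_le (F : T → ℂ) (t : T) : ‖phase F t‖ ≤ 1 := by
  rw [phase, norm_div, Complex.norm_real, norm_norm]
  exact div_self_le_one _

lemma norm_smul_phase_mul (F : T → ℂ) (t : T) (c : ℂ) :
    ‖F t‖ • (phase F t * c) = F t * c := by
  by_cases h : F t = 0
  · simp [h]
  · have : (‖F t‖ : ℂ) ≠ 0 := by simpa using h
    rw [phase, Complex.real_smul]
    field_simp

variable [MeasurableSpace T] {ν : Measure T} {F : T → ℂ}

lemma aemeasurable_phase (hF : Integrable F ν) :
    AEMeasurable (phase F) (ν.withDensity fun t => ‖F t‖ₑ) :=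
  (hF.1.aemeasurable.div (Complex.measurable_ofReal.comp_aemeasurable
    hF.1.aemeasurable.norm)).mono_ac (withDensity_absolutelyContinuous _ _)

lemma isFiniteMeasure_withDensity_enorm (hF : Integrable F ν) :
    IsFiniteMeasure (ν.withDensity fun t => ‖F t‖ₑ) :=
  isFiniteMeasure_withDensity hF.2.ne

lemma withDensity_enorm_real_univ (hF : Integrable F ν) :
    (ν.withDensity fun t => ‖F t‖ₑ).real Set.univ = ∫ t, ‖F t‖ ∂ν := by
  rw [integral_norm_eq_lintegral_enorm hF.1, measureReal_def,
    withDensity_apply _ MeasurableSet.univ, Measure.restrict_univ]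

/-- Absorbing `|F|` into the measure replaces the integrable factor `F` by its phase and the measure
`ν`, which need not be `σ`-finite, by a finite one. -/
lemma integral_phase_mul (hF : Integrable F ν) (h : T → ℂ) :
    ∫ t, phase F t * h t ∂(ν.withDensity fun t => ‖F t‖ₑ) = ∫ t, F t * h t ∂ν := by
  rw [integral_withDensity_eq_integral_toReal_smul₀ hF.1.aemeasurable.enorm
    (ae_of_all _ fun t => enorm_lt_top)]
  simp only [toReal_enorm, norm_smul_phase_mul]

lemma integrable_phase_mul_iff (hF : Integrable F ν) (h : T → ℂ) :
    Integrable (fun t => phase F t * h t) (ν.withDensity fun t => ‖F t‖ₑ) ↔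
      Integrable (fun t => F t * h t) ν := by
  rw [integrable_withDensity_iff_integrable_smul₀' hF.1.aemeasurable.enorm
    (ae_of_all _ fun t => enorm_lt_top)]
  simp only [toReal_enorm, norm_smul_phase_mul]

lemma complexVariance_div {Ω : Type v} [MeasurableSpace Ω] (P : Measure Ω) (Y : Ω → ℂ) (c : ℝ) :
    complexVariance P (fun ω => Y ω / (c : ℂ)) = complexVariance P Y / c ^ 2 := by
  have e : mean P (fun ω => Y ω / (c : ℂ)) = mean P Y / (c : ℂ) := integral_div _ _
  rw [complexVariance, e, complexVariance, ← integral_div]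
  simp only [← sub_div, norm_div, div_pow, Complex.norm_real, Real.norm_eq_abs, sq_abs]

variable {G : Type u} [AddCommGroup G] [TopologicalSpace G] [MeasurableSpace G] {μ : Measure G}
  {f : G → ℂ}

lemma integrand_eq (m : ℕ) (x : Fin 3 → ℤ → G) (γ : CharGroup G) :
    integrand μ f m x γ =
      fourier μ f γ * (∏ j, weightedAgg (fullWeight m) 0 (x j) γ) / (normalizer m : ℂ) := by
  simp only [integrand, agg_eq_weightedAgg, mul_div_assoc]

lemma integrandTrunc_eq (m : ℕ) (a b : ℤ) (x : Fin 3 → ℤ → G) (γ : CharGroup G) :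
    integrandTrunc μ f m a b x γ =
      fourier μ f γ * (∏ j, weightedAgg (truncWeight m a b) (correction m a) (x j) γ) /
        (normalizer m : ℂ) := by
  simp only [integrandTrunc, aggTrunc_sub_correction_eq_weightedAgg, mul_div_assoc]

variable [MeasurableSpace (CharGroup G)] {ν : Measure (CharGroup G)}

lemma estimator_eq (hf : IsRegular μ ν f) (m : ℕ) (x : Fin 3 → ℤ → G) :
    estimator μ ν f m x = weightedEst (ν.withDensity fun γ => ‖fourier μ f γ‖ₑ)
      (phase (fourier μ f)) (fullWeight m) 0 x / (normalizer m : ℂ) := by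
  rw [weightedEst, integral_phase_mul hf.integrable_fourier, ← integral_div]
  simp only [estimator, integrand_eq]

lemma estimatorTrunc_eq (hf : IsRegular μ ν f) (m : ℕ) (a b : ℤ) (x : Fin 3 → ℤ → G) :
    estimatorTrunc μ ν f m a b x = weightedEst (ν.withDensity fun γ => ‖fourier μ f γ‖ₑ)
      (phase (fourier μ f)) (truncWeight m a b) (correction m a) x / (normalizer m : ℂ) := by
  rw [weightedEst, integral_phase_mul hf.integrable_fourier, ← integral_div]
  simp only [estimatorTrunc, integrandTrunc_eq]

end Reduction

lemma Gamma_neg_one_third_ne_zero : Real.Gamma (-1 / 3) ≠ 0 := by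
  refine Real.Gamma_ne_zero fun n h => ?_
  have h1 : (3 : ℝ) * n = 1 := by linarith
  have h2 : 3 * n = 1 := by exact_mod_cast h1
  omega

end PoissonTower

theorem mainTheorem6 :
    ∃ C : ℝ, ∀ (G : Type u) [AddCommGroup G] [TopologicalSpace G] [IsTopologicalAddGroup G]
      [T2Space G] [LocallyCompactSpace G] [MeasurableSpace G] [BorelSpace G]
      [MeasurableSpace (PoissonTower.CharGroup G)] [BorelSpace (PoissonTower.CharGroup G)]
      (μ : Measure G) [μ.IsAddHaarMeasure]
      (ν : Measure (PoissonTower.CharGroup G)) [ν.IsHaarMeasure]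
      (f : G → ℂ) (_hf : PoissonTower.IsRegular μ ν f)
      (Ω : Type v) [MeasurableSpace Ω] (P : Measure Ω) [IsProbabilityMeasure P]
      (m : ℕ) (_hm : 1 ≤ m) (lam : ℝ) (_hlam : 0 < lam)
      (X : Fin 3 → ℤ → Ω → G)
      (_hX : (∃ μR : Measure G, PoissonTower.IsTriplePoissonTower P m lam μR X) ∨
        (∃ (n : ℕ) (x : Fin n → G),
          lam = (PoissonTower.supportSize x : ℝ) ∧ PoissonTower.IsTripleSketch P m x X))
      (a b : ℤ) (_ha : (a : ℝ) ≤ m * (Real.log lam - 6 * Real.log m))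
      (_hb : m * (Real.log lam + 3 * Real.log m) ≤ (b : ℝ)),
      -- both estimators are almost surely well defined and have finite second moments
      (∀ᵐ ω ∂P,
        (∀ j γ, Summable (PoissonTower.aggTerm m (fun k => X j k ω) γ)) ∧
        Integrable (PoissonTower.integrand μ f m (fun j k => X j k ω)) ν ∧
        Integrable (PoissonTower.integrandTrunc μ f m a b (fun j k => X j k ω)) ν) ∧
      MemLp (fun ω => PoissonTower.estimator μ ν f m (fun j k => X j k ω)) 2 P ∧
      MemLp (fun ω => PoissonTower.estimatorTrunc μ ν f m a b (fun j k => X j k ω)) 2 P ∧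
      -- the means
      ‖PoissonTower.mean P
            (fun ω => PoissonTower.estimatorTrunc μ ν f m a b (fun j k => X j k ω)) -
          PoissonTower.mean P
            (fun ω => PoissonTower.estimator μ ν f m (fun j k => X j k ω))‖
        ≤ C * (lam * PoissonTower.fourierNorm μ ν f / (m : ℝ) ^ 2) ∧
      -- the variances
      |PoissonTower.complexVariance P
            (fun ω => PoissonTower.estimatorTrunc μ ν f m a b (fun j k => X j k ω)) -
          PoissonTower.complexVariance P
            (fun ω => PoissonTower.estimator μ ν f m (fun j k => X j k ω))|
        ≤ C * (lam ^ 2 * PoissonTower.fourierNorm μ ν f ^ 2 / (m : ℝ) ^ 2) := by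
  set Γ₀ : ℝ := |Real.Gamma (-1 / 3)| with hΓ₀
  have hΓ : 0 < Γ₀ := abs_pos.2 PoissonTower.Gamma_neg_one_third_ne_zero
  refine ⟨3 * 18 ^ 3 / Γ₀ ^ 3 + 21 * 648 ^ 3 / Γ₀ ^ 6, ?_⟩
  intro G _ _ _ _ _ _ _ _ _ μ _ ν _ f hf Ω _ P _ m hm lam hlam X hX a b ha hb
  have hXs : PoissonTower.IsSparseTower P (PoissonTower.cellProb m (Real.log lam)) X := by
    rcases hX with ⟨μR, h⟩ | ⟨n, x, rfl, h⟩
    · exact h.isSparseTower hlam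
    · exact h.isSparseTower hlam
  have hm' : (0 : ℝ) < m := by exact_mod_cast hm
  have hF := hf.integrable_fourier
  have hρ := PoissonTower.isFiniteMeasure_withDensity_enorm hF
  have hg := PoissonTower.aemeasurable_phase hF
  have hg1 := PoissonTower.norm_phase_le (PoissonTower.fourier μ f)
  have hw := PoissonTower.admissibleWeights_fullWeight hm (Real.log lam)
  have hw' := PoissonTower.admissibleWeights_truncWeight hm (Real.log lam) a b
  have hmean := PoissonTower.norm_mean_sub_le hm hXs ha hb hg hg1
  have hvar := PoissonTower.abs_complexVariance_sub_le hm hXs ha hb hg hg1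
  rw [PoissonTower.withDensity_enorm_real_univ hF, Real.exp_log hlam] at hmean hvar
  have hnorm : PoissonTower.normalizer m = (m : ℝ) ^ 3 * Γ₀ ^ 3 := rfl
  have hN : 0 ≤ PoissonTower.fourierNorm μ ν f := integral_nonneg fun _ => norm_nonneg _
  have hN0 : 0 < PoissonTower.normalizer m := by rw [hnorm]; positivity
  simp only [PoissonTower.estimator_eq hf, PoissonTower.estimatorTrunc_eq hf]
  refine ⟨?_, ?_, ?_, ?_, ?_⟩
  · filter_upwards [hXs.ae_dominator_ne_top hw, hXs.ae_dominator_ne_top hw'] with ω h1 h2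
    refine ⟨fun j γ => (PoissonTower.summable_norm_term hw.nonneg (h1 j) γ).of_norm, ?_, ?_⟩
    · have h := (PoissonTower.integrable_phase_mul_iff hF _).1
        (PoissonTower.integrable_weightedEst hg hg1 hw h1 0)
      exact (h.div_const _).congr (ae_of_all _ fun γ => (PoissonTower.integrand_eq _ _ _).symm)
    · have h := (PoissonTower.integrable_phase_mul_iff hF _).1
        (PoissonTower.integrable_weightedEst hg hg1 hw' h2 (PoissonTower.correction m a))
      exact (h.div_const _).congr
        (ae_of_all _ fun γ => (PoissonTower.integrandTrunc_eq _ _ _ _ _).symm)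
  · simp only [div_eq_mul_inv]
    exact (hXs.memLp_weightedEst hw hg hg1 0).mul_const _
  · simp only [div_eq_mul_inv]
    exact (hXs.memLp_weightedEst hw' hg hg1 _).mul_const _
  · have e : ∀ Y : Ω → ℂ, PoissonTower.mean P (fun ω => Y ω / (PoissonTower.normalizer m : ℂ)) =
        PoissonTower.mean P Y / (PoissonTower.normalizer m : ℂ) := fun Y => integral_div _ _
    rw [e, e, ← sub_div, norm_div, Complex.norm_real, Real.norm_of_nonneg hN0.le,
      div_le_iff₀ hN0]
    refine hmean.trans ?_
    calc 3 * 18 ^ 3 * (m * lam) * PoissonTower.fourierNorm μ ν f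
        = 3 * 18 ^ 3 / Γ₀ ^ 3 * (lam * PoissonTower.fourierNorm μ ν f / (m : ℝ) ^ 2) *
          PoissonTower.normalizer m := by rw [hnorm]; field_simp
      _ ≤ _ := by
        gcongr
        exact le_add_of_nonneg_right (by positivity)
  · rw [PoissonTower.complexVariance_div, PoissonTower.complexVariance_div, ← sub_div, abs_div,
      abs_of_pos (pow_pos hN0 2), div_le_iff₀ (pow_pos hN0 2)]
    refine hvar.trans ?_
    calc 21 * 648 ^ 3 * ((m : ℝ) ^ 4 * lam ^ 2) * PoissonTower.fourierNorm μ ν f ^ 2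
        = 21 * 648 ^ 3 / Γ₀ ^ 6 * (lam ^ 2 * PoissonTower.fourierNorm μ ν f ^ 2 / (m : ℝ) ^ 2) *
          PoissonTower.normalizer m ^ 2 := by rw [hnorm]; field_simp
      _ ≤ _ := by
        gcongr
        exact le_add_of_nonneg_left (by positivity)
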